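/- **Setting.** Let $N\ge 1$, $s\in(0,1)$ with $2s<N$, $p\in\left(1,\frac{N+2s}{N-2s}\right)$, and let $\Omega\subset\mathbb R^N$ be a bounded open set. Let $$H^s_0(\Omega)=\{v\in L^2(\mathbb R^N): v=0 \text{ a.e. in } \mathbb R^N\setminus\Omega,\ \langle v,v\rangle<\infty\},\qquad \langle v,w\rangle=\int_{\mathbb R^N}\int_{\mathbb R^N}\frac{(v(x)-v(y))(w(x)-w(y))}{|x-y|^{N+2s}}\,dx\,dy .$$ Equations are understood weakly, with test functions $w\in H^s_0(\Omega)$, and $(-\Delta)^s$ is normalized so that $(-\Delta)^s v$ tested with $w$ is $\langle v,w\rangle$. Let $\lambda_1(\Omega)$ be the smallest real $\ell$ for which $(-\Delta)^s v=\ell v$ in $\Omega$ has a nontrivial solution $v\in H^s_0(\Omega)$, and let $\lambda<\lambda_1(\Omega)$. Let $u\in H^s_0(\Omega)$ be a least energy solution of $$(-\Delta)^s u=\lambda u+|u|^{p-1}u \ \text{ in }\Omega,\qquad u=0\ \text{ in }\mathbb R^N\setminus\Omega,$$ that is, a weak solution that is a positive multiple of a minimizer of $\Phi(w)=\langle w,w\rangle-\lambda\int_\Omega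 w^2$ among all $w\in H^s_0(\Omega)$ with $\int_\Omega|w|^{p+1}=1$. Consider the linearized eigenvalue problem $$(-\Delta)^s v-p|u|^{p-1}v-\lambda v=\mu v\ \text{ in }\Omega,\qquad v=0\ \text{ in }\mathbb R^N\setminus\Omega,$$ where an eigenfunction is a weak solution $v\in H^s_0(\Omega)\setminus\{0\}$. Let $\mu_1\le\mu_2\le\dots$ be its eigenvalues in nondecreasing order, repeated according to multiplicity; that is, $\mu_k$ is the least real number such that there are $k$ linearly independent eigenfunctions with eigenvalues at most $\mu_k$. **Proposition 3.1.** The eigenvalues $\mu_1$ and $\mu_2$ exist, and $\mu_1<0$. There is an eigenfunction $\varphi\in H^s_0(\Omega)$ for $\mu_1$ that is strictly positive in $\Omega$, in the sense that $\operatorname{ess\,inf}_K\varphi>0$ for every compact set $K\subset\Omega$ of positive measure (so $\varphi>0$ a.e. in $\Omega$, and everywhere in $\Omega$ for a representative that is continuous in $\Omega$). The eigenfunctions for $\mu_1$ are exactly the multiples $c\varphi$ with $c\in\mathbb R\setminus\{0\}$; in particular each of them is strictly of one sign in $\Omega$. Consequently, $\mu_1<\mu_2$. -/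

import Mathlib

open MeasureTheory

noncomputable section

namespace FracLinearized

/-- The Euclidean space `ℝ^N`. -/
abbrev Space (N : ℕ) : Type := EuclideanSpace ℝ (Fin N)

/-- Real-valued functions in `L²(ℝ^N)`, as classes modulo almost everywhere equality. -/
abbrev L2 (N : ℕ) : Type := Lp ℝ 2 (volume : Measure (Space N))

/-- The integrand `(v x - v y) (w x - w y) / |x - y|^(N + 2 s)` on `ℝ^N × ℝ^N`. -/
def gagliardoIntegrand {N : ℕ} (s : ℝ) (v w : Space N → ℝ) (z : Space N × Space N) : ℝ :=
  (v z.1 - v z.2) * (w z.1 - w z.2) / ‖z.1 - z.2‖ ^ ((N : ℝ) + 2 * s)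

/-- The scalar product `⟨v, w⟩`, the double integral of the Gagliardo integrand; `⟨v, v⟩` is the
square of the Gagliardo seminorm of `v`. This is also the weak form of `(-Δ)^s v` tested with
`w`. -/
def gagliardo {N : ℕ} (s : ℝ) (v w : Space N → ℝ) : ℝ :=
  ∫ z : Space N × Space N, gagliardoIntegrand s v w z

lemma gagliardoIntegrand_congr {N : ℕ} (s : ℝ) {v v' : Space N → ℝ}
    (h : v =ᵐ[volume] v') :
    gagliardoIntegrand s v v =ᵐ[volume] gagliardoIntegrand s v' v' := by
  have h1 : ∀ᵐ z : Space N × Space N, v z.1 = v' z.1 :=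
    Measure.quasiMeasurePreserving_fst.ae h
  have h2 : ∀ᵐ z : Space N × Space N, v z.2 = v' z.2 :=
    Measure.quasiMeasurePreserving_snd.ae h
  filter_upwards [h1, h2] with z hz1 hz2
  simp only [gagliardoIntegrand, hz1, hz2]

lemma aestronglyMeasurable_gagliardoIntegrand {N : ℕ} (s : ℝ) {v : Space N → ℝ}
    (hv : AEStronglyMeasurable v volume) :
    AEStronglyMeasurable (gagliardoIntegrand s v v) volume := by
  have h1 : AEStronglyMeasurable (fun z : Space N × Space N => v z.1) volume :=
    hv.comp_quasiMeasurePreserving Measure.quasiMeasurePreserving_fst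
  have h2 : AEStronglyMeasurable (fun z : Space N × Space N => v z.2) volume :=
    hv.comp_quasiMeasurePreserving Measure.quasiMeasurePreserving_snd
  have h3 : Measurable (fun z : Space N × Space N => (‖z.1 - z.2‖ ^ ((N : ℝ) + 2 * s))⁻¹) := by
    fun_prop
  exact (((h1.sub h2).mul (h1.sub h2)).mul h3.aestronglyMeasurable).congr
    (Filter.Eventually.of_forall fun z => by
      simp only [gagliardoIntegrand, div_eq_mul_inv, Pi.mul_apply, Pi.sub_apply])

/-- The fractional Sobolev space `H^s_0(Ω)`: the `L²(ℝ^N)` functions that vanish outside `Ω` and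
have finite Gagliardo seminorm. -/
def Hs0 {N : ℕ} (Ω : Set (Space N)) (s : ℝ) : Submodule ℝ (L2 N) where
  carrier := {v | (∀ᵐ x : Space N, x ∉ Ω → v x = 0) ∧
    Integrable (gagliardoIntegrand s v v) volume}
  zero_mem' := by
    have h0 := Lp.coeFn_zero ℝ 2 (volume : Measure (Space N))
    refine ⟨?_, ?_⟩
    · filter_upwards [h0] with x hx _ using hx
    · refine (integrable_congr (gagliardoIntegrand_congr s h0)).2 ?_
      have h1 : gagliardoIntegrand s (0 : Space N → ℝ) 0 = 0 := by
        funext z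
        simp [gagliardoIntegrand]
      rw [h1]
      exact integrable_zero _ _ _
  add_mem' := by
    rintro v w ⟨hv, hv'⟩ ⟨hw, hw'⟩
    have h0 := Lp.coeFn_add v w
    refine ⟨?_, ?_⟩
    · filter_upwards [h0, hv, hw] with x hx h1 h2 hΩ
      rw [hx, Pi.add_apply, h1 hΩ, h2 hΩ, add_zero]
    · refine (integrable_congr (gagliardoIntegrand_congr s h0)).2 ?_
      refine ((hv'.const_mul 2).add (hw'.const_mul 2)).mono'
        (aestronglyMeasurable_gagliardoIntegrand s
          ((Lp.aestronglyMeasurable v).add (Lp.aestronglyMeasurable w))) ?_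
      refine Filter.Eventually.of_forall fun z => ?_
      have hk : 0 ≤ ‖z.1 - z.2‖ ^ ((N : ℝ) + 2 * s) := by positivity
      simp only [gagliardoIntegrand, Pi.add_apply, Real.norm_eq_abs]
      rw [abs_of_nonneg (div_nonneg (mul_self_nonneg _) hk), ← mul_div_assoc, ← mul_div_assoc,
        ← add_div]
      refine div_le_div_of_nonneg_right ?_ hk
      nlinarith [sq_nonneg ((v z.1 - v z.2) - (w z.1 - w z.2))]
  smul_mem' := by
    rintro c v ⟨hv, hv'⟩
    have h0 := Lp.coeFn_smul c v
    refine ⟨?_, ?_⟩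
    · filter_upwards [h0, hv] with x hx h1 hΩ
      rw [hx, Pi.smul_apply, h1 hΩ, smul_zero]
    · refine (integrable_congr (gagliardoIntegrand_congr s h0)).2 ?_
      refine (hv'.const_mul (c * c)).congr (Filter.Eventually.of_forall fun z => ?_)
      simp only [gagliardoIntegrand, Pi.smul_apply, smul_eq_mul]
      ring

/-- The first eigenvalue `λ₁(Ω)` of the fractional Laplacian with homogeneous Dirichlet
conditions: the smallest real `lam` for which `(-Δ)^s v = lam v` in `Ω` has a nontrivial weak
solution in `H^s_0(Ω)`. -/
def firstDirichletEigenvalue {N : ℕ} (Ω : Set (Space N)) (s : ℝ) : ℝ :=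
  sInf {lam : ℝ | ∃ v ∈ Hs0 Ω s, v ≠ 0 ∧
    ∀ w ∈ Hs0 Ω s, gagliardo s v w = lam * ∫ x in Ω, v x * w x}

/-- The energy `Φ(v) = [v]² - lam ∫_Ω v²`. -/
def energy {N : ℕ} (Ω : Set (Space N)) (s lam : ℝ) (v : L2 N) : ℝ :=
  gagliardo s v v - lam * ∫ x in Ω, v x ^ 2

/-- `w` minimizes `Φ` on `H^s_0(Ω)` under the constraint `∫_Ω |w|^(p+1) = 1`. -/
def IsConstrainedMinimizer {N : ℕ} (Ω : Set (Space N)) (s p lam : ℝ) (w : L2 N) : Prop :=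
  w ∈ Hs0 Ω s ∧ ∫ x in Ω, |w x| ^ (p + 1) = 1 ∧
    ∀ v ∈ Hs0 Ω s, ∫ x in Ω, |v x| ^ (p + 1) = 1 → energy Ω s lam w ≤ energy Ω s lam v

/-- `u` is a weak solution in `H^s_0(Ω)` of `(-Δ)^s u = lam u + |u|^(p-1) u` in `Ω`, `u = 0`
outside `Ω`; for `u ≥ 0` the nonlinearity is `u^p`. -/
def IsWeakSolution {N : ℕ} (Ω : Set (Space N)) (s p lam : ℝ) (u : L2 N) : Prop :=
  u ∈ Hs0 Ω s ∧ ∀ w ∈ Hs0 Ω s,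
    gagliardo s u w = lam * (∫ x in Ω, u x * w x) + ∫ x in Ω, |u x| ^ (p - 1) * u x * w x

/-- A least energy solution: a solution that is a positive multiple of a constrained minimizer.
(The multiple is forced by the equation: it removes the Lagrange multiplier.) -/
def IsLeastEnergySolution {N : ℕ} (Ω : Set (Space N)) (s p lam : ℝ) (u : L2 N) : Prop :=
  IsWeakSolution Ω s p lam u ∧
    ∃ t : ℝ, 0 < t ∧ ∃ w : L2 N, IsConstrainedMinimizer Ω s p lam w ∧ u = t • w

/-- `v` is an eigenfunction with eigenvalue `μ` of the problem linearized at `u`: a nontrivial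
weak solution in `H^s_0(Ω)` of `(-Δ)^s v - p |u|^(p-1) v - lam v = μ v` in `Ω`, `v = 0` outside
`Ω`. -/
def IsEigenfunction {N : ℕ} (Ω : Set (Space N)) (s p lam : ℝ) (u : L2 N) (μ : ℝ) (v : L2 N) :
    Prop :=
  v ∈ Hs0 Ω s ∧ v ≠ 0 ∧ ∀ w ∈ Hs0 Ω s,
    gagliardo s v w - p * (∫ x in Ω, |u x| ^ (p - 1) * v x * w x) - lam * (∫ x in Ω, v x * w x)
      = μ * ∫ x in Ω, v x * w x

/-- `μ` is the `k`-th eigenvalue (`k = 1, 2, …`) of the problem linearized at `u`, when the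
eigenvalues are listed in nondecreasing order and repeated according to their multiplicity:
`μ` is the least real number such that there are `k` linearly independent eigenfunctions with
eigenvalues at most `μ`. -/
def IsKthEigenvalue {N : ℕ} (Ω : Set (Space N)) (s p lam : ℝ) (u : L2 N) (k : ℕ) (μ : ℝ) :
    Prop :=
  IsLeast {m : ℝ | ∃ v : Fin k → L2 N, LinearIndependent ℝ v ∧
    ∀ i, ∃ ν ≤ m, IsEigenfunction Ω s p lam u ν (v i)} μ

/-- `v` is strictly positive in `Ω`: it has a positive essential lower bound on every compact
subset of `Ω`. Hence `v > 0` almost everywhere in `Ω`, and a representative of `v` that is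
continuous in `Ω` is positive at every point of `Ω`. -/
def StrictlyPositiveIn {N : ℕ} (Ω : Set (Space N)) (v : L2 N) : Prop :=
  ∀ K : Set (Space N), IsCompact K → K ⊆ Ω →
    ∃ c : ℝ, 0 < c ∧ ∀ᵐ x : Space N, x ∈ K → c ≤ v x

end FracLinearized

end

namespace FracLinearized
open Filter Topology

/-! ### The Gagliardo form on `Hs0`: bilinearity, contractions, lower semicontinuity. -/

section Gagliardo

variable {N : ℕ} {s : ℝ} {Ω : Set (Space N)}

/-! The argument is variational. Since `u` solves the equation, its energy equals `∫ |u|^(p+1)`,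
which is positive because `u` is a positive multiple of a normalized minimizer. Minimality then
becomes, by homogeneity, a Sobolev inequality `m ‖v‖²_{p+1} ≤ Φ(v)` with `m > 0`
(`IsLeastEnergySolution.sobolev`). By truncation and Hölder, the potential `p |u|^(p-1)` is an
arbitrarily small perturbation of the Gagliardo form, up to a multiple of the `L²` norm
(`exists_potential_le`). So the linearized form `a` is bounded below and comparable with the
Gagliardo form, whose domain embeds compactly into `L²` (`Hs0.totallyBounded`), and its Rayleigh
quotient attains a minimum on closed subspaces (`exists_rayleigh_minimizer`). The minimum over the
whole space is `μ₁`, and the minimum over the orthogonal complement of its eigenfunction is `μ₂`.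

Sign and simplicity: replacing `v` by `|v|` does not increase `a`, so `|v|` and `v + |v|` also solve
the eigenvalue equation for `μ₁`. Nonnegative nonzero eigenfunctions are supersolutions, and the
nonlocal strong maximum principle makes them strictly positive (`exists_bump_le`,
`strictlyPositiveIn_of_supersolution`): the interaction of `(c η - φ)⁺` with a set where `φ` is
bounded below outweighs every other term for small `c`, where `η` is a paraboloid cap. Hence each
eigenfunction for `μ₁` has a strict sign. Two of them cannot be orthogonal, so the eigenspace is a
line, and `μ₁ < μ₂` follows.

Negativity: testing with `u` gives `a(u, u) = (1 - p) Φ(u) < 0`. -/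

lemma gagliardoIntegrand_congr₂ (s : ℝ) {v v' w w' : Space N → ℝ}
    (h : v =ᵐ[volume] v') (h' : w =ᵐ[volume] w') :
    gagliardoIntegrand s v w =ᵐ[volume] gagliardoIntegrand s v' w' := by
  have h1 : ∀ᵐ z : Space N × Space N, v z.1 = v' z.1 :=
    Measure.quasiMeasurePreserving_fst.ae h
  have h2 : ∀ᵐ z : Space N × Space N, v z.2 = v' z.2 :=
    Measure.quasiMeasurePreserving_snd.ae h
  have h3 : ∀ᵐ z : Space N × Space N, w z.1 = w' z.1 :=
    Measure.quasiMeasurePreserving_fst.ae h'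
  have h4 : ∀ᵐ z : Space N × Space N, w z.2 = w' z.2 :=
    Measure.quasiMeasurePreserving_snd.ae h'
  filter_upwards [h1, h2, h3, h4] with z hz1 hz2 hz3 hz4
  simp only [gagliardoIntegrand, hz1, hz2, hz3, hz4]

lemma gagliardo_congr (s : ℝ) {v v' w w' : Space N → ℝ}
    (h : v =ᵐ[volume] v') (h' : w =ᵐ[volume] w') :
    gagliardo s v w = gagliardo s v' w' :=
  integral_congr_ae (gagliardoIntegrand_congr₂ s h h')

lemma aestronglyMeasurable_gagliardoIntegrand₂ (s : ℝ) {v w : Space N → ℝ}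
    (hv : AEStronglyMeasurable v volume) (hw : AEStronglyMeasurable w volume) :
    AEStronglyMeasurable (gagliardoIntegrand s v w) volume := by
  have h1 : AEStronglyMeasurable (fun z : Space N × Space N => v z.1) volume :=
    hv.comp_quasiMeasurePreserving Measure.quasiMeasurePreserving_fst
  have h2 : AEStronglyMeasurable (fun z : Space N × Space N => v z.2) volume :=
    hv.comp_quasiMeasurePreserving Measure.quasiMeasurePreserving_snd
  have h1' : AEStronglyMeasurable (fun z : Space N × Space N => w z.1) volume :=
    hw.comp_quasiMeasurePreserving Measure.quasiMeasurePreserving_fst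
  have h2' : AEStronglyMeasurable (fun z : Space N × Space N => w z.2) volume :=
    hw.comp_quasiMeasurePreserving Measure.quasiMeasurePreserving_snd
  have h3 : Measurable (fun z : Space N × Space N => (‖z.1 - z.2‖ ^ ((N : ℝ) + 2 * s))⁻¹) := by
    fun_prop
  exact (((h1.sub h2).mul (h1'.sub h2')).mul h3.aestronglyMeasurable).congr
    (Filter.Eventually.of_forall fun z => by
      simp only [gagliardoIntegrand, div_eq_mul_inv, Pi.mul_apply, Pi.sub_apply])

lemma gagliardoIntegrand_self_nonneg (s : ℝ) (v : Space N → ℝ) (z : Space N × Space N) :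
    0 ≤ gagliardoIntegrand s v v z :=
  div_nonneg (mul_self_nonneg _) (by positivity)

lemma gagliardo_self_nonneg (s : ℝ) (v : Space N → ℝ) : 0 ≤ gagliardo s v v :=
  integral_nonneg (gagliardoIntegrand_self_nonneg s v)

lemma gagliardo_comm (s : ℝ) (v w : Space N → ℝ) : gagliardo s v w = gagliardo s w v := by
  unfold gagliardo
  congr 1
  funext z
  simp only [gagliardoIntegrand, mul_comm]

lemma integrable_gagliardoIntegrand {v w : Space N → ℝ}
    (hv : AEStronglyMeasurable v volume) (hw : AEStronglyMeasurable w volume)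
    (hv' : Integrable (gagliardoIntegrand s v v)) (hw' : Integrable (gagliardoIntegrand s w w)) :
    Integrable (gagliardoIntegrand s v w) := by
  refine (hv'.add hw').mono' (aestronglyMeasurable_gagliardoIntegrand₂ s hv hw)
    (Eventually.of_forall fun z => ?_)
  have hk : 0 ≤ ‖z.1 - z.2‖ ^ ((N : ℝ) + 2 * s) := by positivity
  simp only [gagliardoIntegrand, Pi.add_apply, Real.norm_eq_abs]
  rw [abs_div, abs_of_nonneg hk, ← add_div, abs_mul]
  refine div_le_div_of_nonneg_right ?_ hk
  nlinarith [sq_nonneg (|v z.1 - v z.2| - |w z.1 - w z.2|), sq_abs (v z.1 - v z.2),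
    sq_abs (w z.1 - w z.2), abs_nonneg (v z.1 - v z.2), abs_nonneg (w z.1 - w z.2),
    mul_nonneg (abs_nonneg (v z.1 - v z.2)) (abs_nonneg (w z.1 - w z.2))]

lemma Hs0.integrable {v w : L2 N} (hv : v ∈ Hs0 Ω s) (hw : w ∈ Hs0 Ω s) :
    Integrable (gagliardoIntegrand s v w) :=
  integrable_gagliardoIntegrand (Lp.aestronglyMeasurable v) (Lp.aestronglyMeasurable w) hv.2 hw.2

lemma gagliardo_add_left {v v' w : L2 N} (hv : v ∈ Hs0 Ω s) (hv' : v' ∈ Hs0 Ω s)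
    (hw : w ∈ Hs0 Ω s) :
    gagliardo s (v + v' : L2 N) w = gagliardo s v w + gagliardo s v' w := by
  rw [gagliardo_congr s (Lp.coeFn_add v v') (EventuallyEq.refl _ _)]
  unfold gagliardo
  rw [← integral_add (Hs0.integrable hv hw) (Hs0.integrable hv' hw)]
  congr 1
  funext z
  simp only [gagliardoIntegrand, Pi.add_apply]
  ring

lemma gagliardo_smul_left (c : ℝ) (v w : L2 N) :
    gagliardo s (c • v : L2 N) w = c * gagliardo s v w := by
  rw [gagliardo_congr s (Lp.coeFn_smul c v) (EventuallyEq.refl _ _)]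
  unfold gagliardo
  rw [← integral_const_mul]
  congr 1
  funext z
  simp only [gagliardoIntegrand, Pi.smul_apply, smul_eq_mul]
  ring

/-- Composition with a contraction fixing `0` acts on `H^s_0(Ω)` and does not increase the
seminorm. -/
lemma gagliardo_comp_le {g : ℝ → ℝ} (hg : LipschitzWith 1 g) (g0 : g 0 = 0) {v : L2 N}
    (hv : v ∈ Hs0 Ω s) :
    hg.compLp g0 v ∈ Hs0 Ω s ∧
      gagliardo s (hg.compLp g0 v) (hg.compLp g0 v) ≤ gagliardo s v v := by
  have h0 := hg.coeFn_compLp g0 v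
  have hle : ∀ᵐ z, gagliardoIntegrand s (hg.compLp g0 v) (hg.compLp g0 v) z ≤
      gagliardoIntegrand s v v z := by
    filter_upwards [gagliardoIntegrand_congr s h0] with z hz
    rw [hz]
    refine div_le_div_of_nonneg_right ?_ (by positivity)
    have := hg.dist_le_mul (v z.1) (v z.2)
    simp only [Real.dist_eq, NNReal.coe_one, one_mul] at this
    simp only [Function.comp_apply, ← sq]
    exact sq_le_sq.2 this
  have hint : Integrable (gagliardoIntegrand s (hg.compLp g0 v) (hg.compLp g0 v)) := by
    refine hv.2.mono' (aestronglyMeasurable_gagliardoIntegrand s (Lp.aestronglyMeasurable _)) ?_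
    filter_upwards [hle] with z hz
    rwa [Real.norm_eq_abs, abs_of_nonneg (gagliardoIntegrand_self_nonneg _ _ _)]
  refine ⟨⟨?_, hint⟩, integral_mono_ae hint hv.2 hle⟩
  filter_upwards [h0, hv.1] with x hx h1 hΩ
  rw [hx, Function.comp_apply, h1 hΩ, g0]

/-- The seminorm is lower semicontinuous under `L²` convergence. -/
lemma Hs0.of_tendsto {v : ℕ → L2 N} {x : L2 N} {M : ℝ} (hv : ∀ n, v n ∈ Hs0 Ω s)
    (hx : Tendsto v atTop (𝓝 x)) (hM : ∀ n, gagliardo s (v n) (v n) ≤ M) :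
    x ∈ Hs0 Ω s ∧ gagliardo s x x ≤ M := by
  have hM0 : 0 ≤ M := (gagliardo_self_nonneg s (v 0)).trans (hM 0)
  -- A subsequence converges almost everywhere, so the integrands converge almost everywhere on the
  -- product and Fatou applies.
  obtain ⟨ns, hns, hae⟩ := (tendstoInMeasure_of_tendsto_Lp hx).exists_seq_tendsto_ae
  have hae1 : ∀ᵐ z : Space N × Space N, Tendsto (fun i => v (ns i) z.1) atTop (𝓝 (x z.1)) :=
    Measure.quasiMeasurePreserving_fst.ae hae
  have hae2 : ∀ᵐ z : Space N × Space N, Tendsto (fun i => v (ns i) z.2) atTop (𝓝 (x z.2)) :=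
    Measure.quasiMeasurePreserving_snd.ae hae
  have hlim : ∀ᵐ z, Tendsto (fun i => gagliardoIntegrand s (v (ns i)) (v (ns i)) z) atTop
      (𝓝 (gagliardoIntegrand s x x z)) := by
    filter_upwards [hae1, hae2] with z h1 h2
    exact (((h1.sub h2).mul (h1.sub h2))).div_const _
  have hbound : ∫⁻ z, ENNReal.ofReal (gagliardoIntegrand s x x z) ≤ ENNReal.ofReal M := by
    calc ∫⁻ z, ENNReal.ofReal (gagliardoIntegrand s x x z)
        = ∫⁻ z, liminf (fun i => ENNReal.ofReal
            (gagliardoIntegrand s (v (ns i)) (v (ns i)) z)) atTop := by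
          refine lintegral_congr_ae ?_
          filter_upwards [hlim] with z hz
          exact ((ENNReal.continuous_ofReal.tendsto _).comp hz).liminf_eq.symm
      _ ≤ liminf (fun i => ∫⁻ z, ENNReal.ofReal
            (gagliardoIntegrand s (v (ns i)) (v (ns i)) z)) atTop := by
          refine lintegral_liminf_le' fun i => ?_
          exact (aestronglyMeasurable_gagliardoIntegrand s
            (Lp.aestronglyMeasurable (v (ns i)))).aemeasurable.ennreal_ofReal
      _ ≤ ENNReal.ofReal M := by
          refine liminf_le_of_le (by isBoundedDefault) fun b hb => ?_
          obtain ⟨i, hi⟩ := hb.exists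
          refine hi.trans ?_
          rw [← ofReal_integral_eq_lintegral_ofReal (hv (ns i)).2
            (Eventually.of_forall (gagliardoIntegrand_self_nonneg s _))]
          exact ENNReal.ofReal_le_ofReal (hM _)
  have hmeas := aestronglyMeasurable_gagliardoIntegrand s (Lp.aestronglyMeasurable x)
  have hint : Integrable (gagliardoIntegrand s x x) := by
    refine ⟨hmeas, ?_⟩
    rw [hasFiniteIntegral_iff_ofReal
      (Eventually.of_forall (gagliardoIntegrand_self_nonneg s _))]
    exact hbound.trans_lt ENNReal.ofReal_lt_top
  refine ⟨⟨?_, hint⟩, ?_⟩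
  · have hall : ∀ᵐ y : Space N, ∀ n, y ∉ Ω → v n y = 0 := ae_all_iff.2 fun n => (hv n).1
    filter_upwards [hae, hall] with y hy h0 hΩ
    refine tendsto_nhds_unique hy ?_
    simp only [h0 _ hΩ]
    exact tendsto_const_nhds
  · unfold gagliardo
    rw [integral_eq_lintegral_of_nonneg_ae
      (Eventually.of_forall (gagliardoIntegrand_self_nonneg s _)) hmeas]
    exact ENNReal.toReal_le_of_le_ofReal hM0 hbound

/-- Functions in `Hs0` vanish almost everywhere off `Ω`. This turns the integrals over `Ω` in the
weak equations into `L²` inner products, so that the abstract Hilbert space lemmas apply. -/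
lemma Hs0.setIntegral_eq {v w : L2 N} (hv : v ∈ Hs0 Ω s) (hΩ : MeasurableSet Ω) :
    ∫ x in Ω, v x * w x = inner ℝ v w := by
  rw [L2.inner_def, ← integral_indicator hΩ]
  refine integral_congr_ae ?_
  filter_upwards [hv.1] with x hx
  by_cases h : x ∈ Ω
  · simp [h, mul_comm]
  · simp [h, hx h]

end Gagliardo

/-! ### Compact embedding of `Hs0` into `L²`. -/

section Compactness

variable {N : ℕ} {s : ℝ} {Ω : Set (Space N)}

lemma norm_sub_le_of_mem_cube {ε : ℝ} {a : Fin N → ℝ} {x y : Space N}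
    (hx : ∀ i, x i ∈ Set.Ico (a i) (a i + ε)) (hy : ∀ i, y i ∈ Set.Ico (a i) (a i + ε)) :
    ‖x - y‖ ≤ √N * ε := by
  rcases Nat.eq_zero_or_pos N with rfl | hN
  · rw [EuclideanSpace.norm_eq]; simp
  have hε : 0 ≤ ε := by
    have := hx ⟨0, hN⟩
    linarith [this.1, this.2]
  rw [EuclideanSpace.norm_eq]
  refine Real.sqrt_le_iff.2 ⟨by positivity, ?_⟩
  rw [mul_pow, Real.sq_sqrt (by positivity)]
  calc ∑ i, ‖(x - y) i‖ ^ 2 ≤ ∑ _i : Fin N, ε ^ 2 := by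
        refine Finset.sum_le_sum fun i _ => ?_
        have h1 := hx i
        have h2 := hy i
        rw [Real.norm_eq_abs, PiLp.sub_apply]
        have : |x i - y i| ≤ ε := abs_le.2 ⟨by linarith [h1.1, h2.2], by linarith [h1.2, h2.1]⟩
        gcongr
    _ = N * ε ^ 2 := by simp

lemma volume_cube (ε : ℝ) (a : Fin N → ℝ) :
    volume {x : Space N | ∀ i, x i ∈ Set.Ico (a i) (a i + ε)} = ENNReal.ofReal ε ^ N := by
  have h : {x : Space N | ∀ i, x i ∈ Set.Ico (a i) (a i + ε)} =
      (WithLp.ofLp : Space N → Fin N → ℝ) ⁻¹'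
        (Set.univ.pi fun i => Set.Ico (a i) (a i + ε)) := by
    ext x; simp
  rw [h, (PiLp.volume_preserving_ofLp (Fin N)).measure_preimage
    (MeasurableSet.univ_pi fun i => measurableSet_Ico).nullMeasurableSet, Real.volume_pi_Ico]
  simp

lemma measurableSet_cube (ε : ℝ) (a : Fin N → ℝ) :
    MeasurableSet {x : Space N | ∀ i, x i ∈ Set.Ico (a i) (a i + ε)} := by
  have h : {x : Space N | ∀ i, x i ∈ Set.Ico (a i) (a i + ε)} =
      (WithLp.ofLp : Space N → Fin N → ℝ) ⁻¹'
        (Set.univ.pi fun i => Set.Ico (a i) (a i + ε)) := by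
    ext x; simp
  rw [h]
  exact (PiLp.volume_preserving_ofLp (Fin N)).measurable
    (MeasurableSet.univ_pi fun i => measurableSet_Ico)

/-- A bounded set is covered by finitely many disjoint cells whose diameters are small compared
with their volumes. -/
lemma exists_fine_partition (hs : 0 < s) (hΩ : Bornology.IsBounded Ω) {δ : ℝ} (hδ : 0 < δ) :
    ∃ (t : Finset (Fin N → ℤ)) (Q : t → Set (Space N)), (∀ i, MeasurableSet (Q i)) ∧
      Pairwise (Function.onFun Disjoint Q) ∧ Ω ⊆ ⋃ i, Q i ∧
      (∀ i, volume (Q i) ≠ 0 ∧ volume (Q i) ≠ ⊤) ∧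
      ∀ i, ∀ x ∈ Q i, ∀ y ∈ Q i, ‖x - y‖ ^ ((N : ℝ) + 2 * s) ≤ δ * volume.real (Q i) := by
  -- In a cube of side `ε` distances are at most `√N ε`, and `(√N ε)^(N+2s)` is the cell volume
  -- `ε^N` times `√N^(N+2s) ε^(2s)`. The last factor tends to `0` because `s > 0`.
  obtain ⟨ε, hε, hεδ⟩ : ∃ ε : ℝ, 0 < ε ∧ √N ^ ((N : ℝ) + 2 * s) * ε ^ (2 * s) ≤ δ := by
    have h1 : Tendsto (fun ε : ℝ => √N ^ ((N : ℝ) + 2 * s) * ε ^ (2 * s)) (𝓝[>] 0) (𝓝 0) := by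
      have : ContinuousAt (fun ε : ℝ => √N ^ ((N : ℝ) + 2 * s) * ε ^ (2 * s)) 0 :=
        continuousAt_const.mul (Real.continuousAt_rpow_const _ _ (Or.inr (by positivity)))
      have h2 := this.tendsto
      simp only [Real.zero_rpow (by positivity : 2 * s ≠ 0), mul_zero] at h2
      exact h2.mono_left nhdsWithin_le_nhds
    obtain ⟨ε, h2, h3⟩ := ((h1.eventually_lt_const hδ).and self_mem_nhdsWithin).exists
    exact ⟨ε, h3, h2.le⟩
  obtain ⟨R, hR⟩ := hΩ.exists_norm_le
  set Q : (Fin N → ℤ) → Set (Space N) := fun k =>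
    {x | ∀ i, x i ∈ Set.Ico (k i * ε) (k i * ε + ε)} with hQ
  have hvol : ∀ k, volume (Q k) = ENNReal.ofReal ε ^ N := fun k => volume_cube ε _
  have hfloor : ∀ k x, x ∈ Q k → ∀ i, ⌊x i / ε⌋ = k i := by
    intro k x hx i
    rw [Int.floor_eq_iff, le_div_iff₀ hε, div_lt_iff₀ hε, add_mul, one_mul]
    exact hx i
  refine ⟨Fintype.piFinset fun _ => Finset.Icc ⌊-R / ε⌋ ⌊R / ε⌋, fun k => Q k,
    fun k => measurableSet_cube ε _, ?_, ?_, ?_, ?_⟩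
  · intro k l hkl
    refine Set.disjoint_left.2 fun x hk hl => hkl (Subtype.ext (funext fun i => ?_))
    rw [← hfloor _ x hk i, hfloor _ x hl i]
  · intro x hx
    have hxi : ∀ i, |x i| ≤ R := fun i => (PiLp.norm_apply_le x i).trans (hR x hx)
    refine Set.mem_iUnion.2 ⟨⟨fun i => ⌊x i / ε⌋, ?_⟩, fun i => ?_⟩
    · refine Fintype.mem_piFinset.2 fun i => Finset.mem_Icc.2 ⟨Int.floor_mono ?_,
        Int.floor_mono ?_⟩
      · exact div_le_div_of_nonneg_right (abs_le.1 (hxi i)).1 hε.le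
      · exact div_le_div_of_nonneg_right (abs_le.1 (hxi i)).2 hε.le
    · have := (Int.floor_eq_iff (a := x i / ε)).1 rfl
      rw [le_div_iff₀ hε, div_lt_iff₀ hε, add_mul, one_mul] at this
      exact this
  · intro k
    rw [hvol]
    exact ⟨pow_ne_zero _ (ENNReal.ofReal_pos.2 hε).ne', ENNReal.pow_ne_top ENNReal.ofReal_ne_top⟩
  · intro k x hx y hy
    rw [measureReal_def, hvol, ENNReal.toReal_pow, ENNReal.toReal_ofReal hε.le]
    calc ‖x - y‖ ^ ((N : ℝ) + 2 * s) ≤ (√N * ε) ^ ((N : ℝ) + 2 * s) :=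
          Real.rpow_le_rpow (norm_nonneg _) (norm_sub_le_of_mem_cube hx hy) (by positivity)
      _ = √N ^ ((N : ℝ) + 2 * s) * ε ^ (2 * s) * ε ^ N := by
          rw [Real.mul_rpow (by positivity) hε.le, Real.rpow_add hε, Real.rpow_natCast]
          ring
      _ ≤ δ * ε ^ N := by gcongr

/-- Poincaré inequality on one cell. -/
lemma exists_const_approx {v : L2 N} (hv : v ∈ Hs0 Ω s) {Q : Set (Space N)}
    (hQ : MeasurableSet Q) (hQ0 : volume Q ≠ 0) (hQt : volume Q ≠ ⊤) {δ : ℝ}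
    (hδ : ∀ x ∈ Q, ∀ y ∈ Q, ‖x - y‖ ^ ((N : ℝ) + 2 * s) ≤ δ * volume.real Q) :
    ∃ c : ℝ, ∫ x in Q, (v x - c) ^ 2 ≤ δ * ∫ z in Q ×ˢ Q, gagliardoIntegrand s v v z := by
  have hm : 0 < volume.real Q := ENNReal.toReal_pos hQ0 hQt
  set ν := (volume : Measure (Space N)).restrict Q with hν
  have hprod : (volume : Measure (Space N × Space N)).restrict (Q ×ˢ Q) = ν.prod ν := by
    rw [hν, Measure.prod_restrict]; rfl
  have hmeas : AEStronglyMeasurable (fun z : Space N × Space N => (v z.1 - v z.2) ^ 2)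
      (volume.restrict (Q ×ˢ Q)) := by
    have h1 : AEStronglyMeasurable (fun z : Space N × Space N => v z.1) volume :=
      (Lp.aestronglyMeasurable v).comp_quasiMeasurePreserving Measure.quasiMeasurePreserving_fst
    have h2 : AEStronglyMeasurable (fun z : Space N × Space N => v z.2) volume :=
      (Lp.aestronglyMeasurable v).comp_quasiMeasurePreserving Measure.quasiMeasurePreserving_snd
    exact ((h1.sub h2).pow 2).restrict
  have hle : ∀ᵐ z ∂(volume.restrict (Q ×ˢ Q)), (v z.1 - v z.2) ^ 2 ≤
      δ * volume.real Q * gagliardoIntegrand s v v z := by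
    refine (ae_restrict_iff' (hQ.prod hQ)).2 (Eventually.of_forall fun z hz => ?_)
    by_cases h : z.1 = z.2
    · simp [gagliardoIntegrand, h]
    · have hpos : 0 < ‖z.1 - z.2‖ ^ ((N : ℝ) + 2 * s) :=
        Real.rpow_pos_of_pos (norm_pos_iff.2 (sub_ne_zero.2 h)) _
      unfold gagliardoIntegrand
      rw [← mul_div_assoc, le_div_iff₀ hpos, ← sq, mul_comm]
      exact mul_le_mul_of_nonneg_right (hδ _ hz.1 _ hz.2) (sq_nonneg _)
  have hgi : Integrable (fun z => δ * volume.real Q * gagliardoIntegrand s v v z)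
      (volume.restrict (Q ×ˢ Q)) := (hv.2.restrict).const_mul _
  have hint : Integrable (fun z : Space N × Space N => (v z.1 - v z.2) ^ 2)
      (volume.restrict (Q ×ˢ Q)) := by
    refine hgi.mono' hmeas ?_
    filter_upwards [hle] with z hz
    rwa [Real.norm_eq_abs, abs_of_nonneg (sq_nonneg _)]
  have hmono := integral_mono_ae hint hgi hle
  rw [integral_const_mul] at hmono
  have hint' := hint
  rw [hprod] at hint' 
  have : IsFiniteMeasure ν := ⟨by rw [hν, Measure.restrict_apply_univ]; exact hQt.lt_top⟩
  have hν0 : ν ≠ 0 := by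
    rw [hν]; exact fun h => hQ0 (Measure.restrict_eq_zero.1 h)
  -- The constant is a value `v y` at a point where `∫ (v x - v y)² dx` does not exceed its mean
  -- over `y` in the cell. The factor `1 / |Q|` of the mean cancels the volume in the bound on the
  -- kernel.
  obtain ⟨y, hy⟩ := exists_le_average hν0 hint'.integral_prod_right
  refine ⟨v y, hy.trans ?_⟩
  rw [average_eq, ← integral_prod_symm _ hint', ← hprod]
  have hνr : ν.real Set.univ = volume.real Q := by simp [hν, measureReal_def]
  rw [hνr, smul_eq_mul, inv_mul_le_iff₀ hm]
  calc _ ≤ _ := hmono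
    _ = _ := by ring

/-- The Poincaré inequality is summed over the cells: the squares `Q i ×ˢ Q i` are disjoint in the
product, so their energies add up to at most the whole seminorm. Nothing is lost outside the cells,
since they cover `Ω`. The span does not depend on `v`, which is what gives total boundedness. -/
lemma exists_step_approx {v : L2 N} (hv : v ∈ Hs0 Ω s) {ι : Type*} [Fintype ι]
    {Q : ι → Set (Space N)} (hQ : ∀ i, MeasurableSet (Q i))
    (hdisj : Pairwise (Function.onFun Disjoint Q)) (hcov : Ω ⊆ ⋃ i, Q i)
    (hQt : ∀ i, volume (Q i) ≠ 0 ∧ volume (Q i) ≠ ⊤) {δ : ℝ} (hδ0 : 0 ≤ δ)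
    (hδ : ∀ i, ∀ x ∈ Q i, ∀ y ∈ Q i, ‖x - y‖ ^ ((N : ℝ) + 2 * s) ≤ δ * volume.real (Q i)) :
    ∃ g ∈ Submodule.span ℝ (Set.range fun i =>
        indicatorConstLp 2 (hQ i) (hQt i).2 (1 : ℝ)), ‖v - g‖ ^ 2 ≤ δ * gagliardo s v v := by
  choose c hc using fun i => exists_const_approx hv (hQ i) (hQt i).1 (hQt i).2 (hδ i)
  set e : ι → L2 N := fun i => indicatorConstLp 2 (hQ i) (hQt i).2 (1 : ℝ) with he
  refine ⟨∑ i, c i • e i, Submodule.sum_mem _ fun i _ =>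
    Submodule.smul_mem _ _ (Submodule.subset_span ⟨i, rfl⟩), ?_⟩
  set g : L2 N := ∑ i, c i • e i with hg
  have hgae : ∀ᵐ x, g x = ∑ i, c i * (Q i).indicator 1 x := by
    have h1 : ∀ᵐ x, ∀ i, (c i • e i : L2 N) x = c i * (Q i).indicator 1 x := by
      refine ae_all_iff.2 fun i => ?_
      filter_upwards [Lp.coeFn_smul (c i) (e i), indicatorConstLp_coeFn (p := 2) (hs := hQ i)
        (hμs := (hQt i).2) (c := (1 : ℝ))] with x hx hx'
      rw [hx, Pi.smul_apply, he, hx']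
      rfl
    filter_upwards [Lp.coeFn_finsetSum Finset.univ (fun i => c i • e i), h1] with x hx hx'
    rw [hg, hx, Finset.sum_apply]
    exact Finset.sum_congr rfl fun i _ => hx' i
  have hin : ∀ i, ∀ x ∈ Q i, ∑ j, c j * (Q j).indicator 1 x = c i := by
    intro i x hx
    rw [Finset.sum_eq_single i]
    · simp [hx]
    · intro j _ hji
      have : x ∉ Q j := fun hj => Set.disjoint_left.1 (hdisj hji) hj hx
      simp [this]
    · simp
  have hsub := Lp.coeFn_sub v g
  have hsq : Integrable (fun x => ((v - g : L2 N) x) ^ 2) := (Lp.memLp (v - g)).integrable_sq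
  have hnorm : ‖v - g‖ ^ 2 = ∫ x, ((v - g : L2 N) x) ^ 2 := by
    rw [← real_inner_self_eq_norm_sq, L2.inner_def]
    simp [sq]
  have hU : MeasurableSet (⋃ i, Q i) := MeasurableSet.iUnion hQ
  have hout : ∫ x, ((v - g : L2 N) x) ^ 2 = ∫ x in ⋃ i, Q i, ((v - g : L2 N) x) ^ 2 := by
    rw [← integral_indicator hU]
    refine integral_congr_ae ?_
    filter_upwards [hsub, hgae, hv.1] with x h1 h2 h3
    by_cases hx : x ∈ ⋃ i, Q i
    · simp only [Set.indicator_of_mem hx]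
    · simp only [Set.indicator_of_notMem hx]
      rw [h1, Pi.sub_apply, h2, h3 fun h => hx (hcov h)]
      have : ∀ i, x ∉ Q i := fun i hi => hx (Set.mem_iUnion.2 ⟨i, hi⟩)
      simp [this]
  rw [hnorm, hout, integral_iUnion_fintype hQ hdisj fun i => hsq.integrableOn]
  calc ∑ i, ∫ x in Q i, ((v - g : L2 N) x) ^ 2
      = ∑ i, ∫ x in Q i, (v x - c i) ^ 2 := by
        refine Finset.sum_congr rfl fun i _ => setIntegral_congr_ae (hQ i) ?_
        filter_upwards [hsub, hgae] with x h1 h2 hx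
        rw [h1, Pi.sub_apply, h2, hin i x hx]
    _ ≤ ∑ i, δ * ∫ z in Q i ×ˢ Q i, gagliardoIntegrand s v v z :=
        Finset.sum_le_sum fun i _ => hc i
    _ = δ * ∫ z in ⋃ i, Q i ×ˢ Q i, gagliardoIntegrand s v v z := by
        rw [← Finset.mul_sum, integral_iUnion_fintype (fun i => (hQ i).prod (hQ i)) ?_
          fun i => hv.2.integrableOn]
        intro i j hij
        exact Set.disjoint_prod.2 (Or.inl (hdisj hij))
    _ ≤ δ * gagliardo s v v := by
        refine mul_le_mul_of_nonneg_left ?_ hδ0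
        exact setIntegral_le_integral hv.2
          (Eventually.of_forall (gagliardoIntegrand_self_nonneg s _))

/-- Bounded subsets of `H^s_0(Ω)` are totally bounded in `L²`. -/
lemma Hs0.totallyBounded (hs : 0 < s) (hΩ : Bornology.IsBounded Ω) (M R : ℝ) :
    TotallyBounded {v : L2 N | v ∈ Hs0 Ω s ∧ gagliardo s v v ≤ M ∧ ‖v‖ ≤ R} := by
  refine Metric.totallyBounded_iff.2 fun ε hε => ?_
  set δ : ℝ := (ε / 2) ^ 2 / (|M| + 1) with hδ
  have hδ0 : 0 < δ := by positivity
  obtain ⟨t, Q, hQ, hdisj, hcov, hQt, hδQ⟩ := exists_fine_partition (N := N) hs hΩ hδ0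
  set W := Submodule.span ℝ (Set.range fun i =>
        indicatorConstLp 2 (hQ i) (hQt i).2 (1 : ℝ)) with hW
  have : FiniteDimensional ℝ W := FiniteDimensional.span_of_finite ℝ (Set.finite_range _)
  -- One ball of the finite-dimensional space `W` comes within `ε / 2` of every `v` in the set, so
  -- an `ε / 2`-net of that ball is an `ε`-net of the set.
  have hK : IsCompact ((↑) '' Metric.closedBall (0 : W) (R + ε / 2) : Set (L2 N)) :=
    (isCompact_closedBall (0 : W) _).image continuous_subtype_val
  obtain ⟨T, hT, hTK⟩ := Metric.totallyBounded_iff.1 hK.totallyBounded (ε / 2) (by positivity)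
  refine ⟨T, hT, ?_⟩
  rintro v ⟨hv, hvM, hvR⟩
  obtain ⟨g, hg, hvg⟩ := exists_step_approx hv hQ hdisj hcov hQt hδ0.le hδQ
  have hdist : ‖v - g‖ < ε / 2 := by
    refine lt_of_pow_lt_pow_left₀ 2 (by positivity) (hvg.trans_lt ?_)
    calc δ * gagliardo s v v ≤ δ * |M| :=
          mul_le_mul_of_nonneg_left (hvM.trans (le_abs_self M)) hδ0.le
      _ < δ * (|M| + 1) := by nlinarith
      _ = (ε / 2) ^ 2 := by rw [hδ]; field_simp
  have hgn : ‖g‖ ≤ R + ε / 2 := by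
    have : ‖g‖ ≤ ‖v‖ + ‖v - g‖ := by
      calc ‖g‖ = ‖v - (v - g)‖ := by rw [sub_sub_cancel]
        _ ≤ _ := norm_sub_le _ _
    linarith
  have hgK : g ∈ ((↑) '' Metric.closedBall (0 : W) (R + ε / 2) : Set (L2 N)) :=
    ⟨⟨g, hg⟩, by simpa using hgn, rfl⟩
  obtain ⟨y, hyT, hy⟩ := Set.mem_iUnion₂.1 (hTK hgK)
  refine Set.mem_iUnion₂.2 ⟨y, hyT, ?_⟩
  rw [Metric.mem_ball] at hy ⊢
  calc dist v y ≤ dist v g + dist g y := dist_triangle _ _ _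
    _ < ε / 2 + ε / 2 := by rw [dist_eq_norm v g]; exact add_lt_add hdist hy
    _ = ε := by ring

/-- The embedding of `H^s_0(Ω)` into `L²` is compact. -/
lemma Hs0.exists_tendsto_subseq (hs : 0 < s) (hΩ : Bornology.IsBounded Ω) {M R : ℝ}
    {v : ℕ → L2 N} (hv : ∀ n, v n ∈ Hs0 Ω s) (hM : ∀ n, gagliardo s (v n) (v n) ≤ M)
    (hR : ∀ n, ‖v n‖ ≤ R) :
    ∃ (x : L2 N) (ns : ℕ → ℕ), StrictMono ns ∧ Tendsto (v ∘ ns) atTop (𝓝 x) := by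
  have hc : IsCompact (closure {v : L2 N | v ∈ Hs0 Ω s ∧ gagliardo s v v ≤ M ∧ ‖v‖ ≤ R}) :=
    (Hs0.totallyBounded hs hΩ M R).closure.isCompact_of_isClosed isClosed_closure
  obtain ⟨x, -, ns, h1, h2⟩ := hc.tendsto_subseq fun n =>
    subset_closure (⟨hv n, hM n, hR n⟩ : v n ∈ {v : L2 N | v ∈ Hs0 Ω s ∧ _ ∧ _})
  exact ⟨x, ns, h1, h2⟩

end Compactness

/-! ### A paraboloid cap as a barrier for the fractional Laplacian. -/

section Bump

variable {N : ℕ} {s : ℝ} {Ω : Set (Space N)}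

/-- The kernel `min (|h|²) (r²) / |h|^(N + 2 s)`. -/
noncomputable def truncKernel {N : ℕ} (s r : ℝ) (h : Space N) : ℝ :=
  min (‖h‖ ^ 2) (r ^ 2) / ‖h‖ ^ ((N : ℝ) + 2 * s)

lemma truncKernel_nonneg (s r : ℝ) (h : Space N) : 0 ≤ truncKernel s r h :=
  div_nonneg (le_min (sq_nonneg _) (sq_nonneg _)) (by positivity)

/-- In polar coordinates the kernel becomes `min (y²) (r²) * y^(-1-2s)` on the half line. Near `0`
this is `y^(1-2s)`, integrable because `s < 1`; at infinity it is a multiple of `y^(-1-2s)`,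
integrable because `s > 0`. -/
lemma integrable_truncKernel (hN : 0 < N) (hs0 : 0 < s) (hs1 : s < 1) {r : ℝ} (hr : 0 < r) :
    Integrable (truncKernel s r : Space N → ℝ) := by
  have : Nonempty (Fin N) := ⟨⟨0, hN⟩⟩
  have hnt : Nontrivial (Space N) := inferInstance
  have key := integrable_fun_norm_addHaar (E := Space N) volume
    (f := fun y : ℝ => min (y ^ 2) (r ^ 2) / y ^ ((N : ℝ) + 2 * s))
  refine key.2 ?_
  have hdim : Module.finrank ℝ (Space N) = N := by simp
  rw [hdim]
  have hpt : ∀ y : ℝ, 0 < y → y ^ (N - 1) • (min (y ^ 2) (r ^ 2) / y ^ ((N : ℝ) + 2 * s)) =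
      min (y ^ 2) (r ^ 2) * y ^ (-1 - 2 * s) := by
    intro y hy
    have h1 : y ^ ((N : ℝ) + 2 * s) = y ^ (N - 1) * y ^ (1 + 2 * s) := by
      rw [← Real.rpow_natCast y (N - 1), ← Real.rpow_add hy]
      congr 1
      rw [Nat.cast_sub hN]
      push_cast
      ring
    have h2 : y ^ (-1 - 2 * s) = (y ^ (1 + 2 * s))⁻¹ := by
      rw [← Real.rpow_neg hy.le]
      congr 1
      ring
    have h3 : y ^ (N - 1) ≠ 0 := (pow_pos hy _).ne'
    have h4 : y ^ (1 + 2 * s) ≠ 0 := (Real.rpow_pos_of_pos hy _).ne'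
    rw [h1, h2, smul_eq_mul]
    field_simp
  have hmeas : Measurable fun y : ℝ => y ^ (N - 1) • (min (y ^ 2) (r ^ 2) /
      y ^ ((N : ℝ) + 2 * s)) := by fun_prop
  rw [← Set.Ioc_union_Ioi_eq_Ioi hr.le]
  refine IntegrableOn.union ?_ ?_
  · have hi : IntegrableOn (fun y : ℝ => y ^ (1 - 2 * s)) (Set.Ioc 0 r) := by
      rw [← intervalIntegrable_iff_integrableOn_Ioc_of_le hr.le]
      exact intervalIntegral.intervalIntegrable_rpow' (by linarith)
    refine hi.mono' hmeas.aestronglyMeasurable.restrict ?_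
    refine (ae_restrict_iff' measurableSet_Ioc).2 (Eventually.of_forall fun y hy => ?_)
    rw [hpt y hy.1, Real.norm_of_nonneg (mul_nonneg (le_min (sq_nonneg _) (sq_nonneg _))
      (Real.rpow_nonneg hy.1.le _))]
    calc min (y ^ 2) (r ^ 2) * y ^ (-1 - 2 * s) ≤ y ^ 2 * y ^ (-1 - 2 * s) :=
          mul_le_mul_of_nonneg_right (min_le_left _ _) (Real.rpow_nonneg hy.1.le _)
      _ = y ^ (1 - 2 * s) := by
          rw [← Real.rpow_natCast y 2, ← Real.rpow_add hy.1]
          congr 1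
          push_cast
          ring
  · have hi : IntegrableOn (fun y : ℝ => r ^ 2 * y ^ (-1 - 2 * s)) (Set.Ioi r) :=
      (integrableOn_Ioi_rpow_of_lt (by linarith) hr).const_mul _
    refine hi.mono' hmeas.aestronglyMeasurable.restrict ?_
    refine (ae_restrict_iff' measurableSet_Ioi).2 (Eventually.of_forall fun y hy => ?_)
    have hy0 : 0 < y := hr.trans hy
    rw [hpt y hy0, Real.norm_of_nonneg (mul_nonneg (le_min (sq_nonneg _) (sq_nonneg _))
      (Real.rpow_nonneg hy0.le _))]
    exact mul_le_mul_of_nonneg_right (min_le_right _ _) (Real.rpow_nonneg hy0.le _)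

/-- The paraboloid cap `(r² - |x - x₀|²)⁺`. -/
noncomputable def bump {N : ℕ} (x₀ : Space N) (r : ℝ) (x : Space N) : ℝ := max (r ^ 2 - ‖x - x₀‖ ^ 2) 0

lemma bump_nonneg (x₀ : Space N) (r : ℝ) (x : Space N) : 0 ≤ bump x₀ r x := le_max_right _ _

lemma bump_le (x₀ : Space N) (r : ℝ) (x : Space N) : bump x₀ r x ≤ r ^ 2 :=
  max_le (by nlinarith [sq_nonneg ‖x - x₀‖]) (sq_nonneg _)

lemma continuous_bump (x₀ : Space N) (r : ℝ) : Continuous (bump x₀ r) := by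
  unfold bump; fun_prop

lemma bump_eq_zero {x₀ : Space N} {r : ℝ} (hr : 0 ≤ r) {x : Space N}
    (hx : x ∉ Metric.ball x₀ r) : bump x₀ r x = 0 := by
  refine max_eq_right ?_
  rw [Metric.mem_ball, not_lt, dist_eq_norm] at hx
  nlinarith

/-- The cap equals `r² - min (|x - x₀|) r ^ 2`; a difference of squares factors, and the sum of the
two truncated distances is at most `2 r`. -/
lemma abs_bump_sub_le {r : ℝ} (hr : 0 ≤ r) (x₀ x y : Space N) :
    |bump x₀ r x - bump x₀ r y| ≤ 2 * r * ‖x - y‖ := by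
  have h : ∀ z, bump x₀ r z = r ^ 2 - min ‖z - x₀‖ r ^ 2 := by
    intro z
    unfold bump
    rcases le_total ‖z - x₀‖ r with hz | hz
    · rw [min_eq_left hz, max_eq_left]
      nlinarith [norm_nonneg (z - x₀)]
    · rw [min_eq_right hz, max_eq_right, sub_self]
      nlinarith
  have hlip : |min ‖y - x₀‖ r - min ‖x - x₀‖ r| ≤ ‖x - y‖ := by
    refine (abs_min_sub_min_le_max _ _ _ _).trans (max_le ?_ (by simp))
    refine (abs_norm_sub_norm_le _ _).trans ?_
    rw [sub_sub_sub_cancel_right, norm_sub_rev]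
  have hx0 : 0 ≤ min ‖x - x₀‖ r := le_min (norm_nonneg _) hr
  have hy0 : 0 ≤ min ‖y - x₀‖ r := le_min (norm_nonneg _) hr
  rw [h, h, show r ^ 2 - min ‖x - x₀‖ r ^ 2 - (r ^ 2 - min ‖y - x₀‖ r ^ 2) =
    (min ‖y - x₀‖ r + min ‖x - x₀‖ r) * (min ‖y - x₀‖ r - min ‖x - x₀‖ r) by ring, abs_mul,
    abs_of_nonneg (add_nonneg hy0 hx0)]
  exact mul_le_mul (by linarith [min_le_right ‖x - x₀‖ r, min_le_right ‖y - x₀‖ r]) hlip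
    (abs_nonneg _) (by positivity)

/-- By the parallelogram law the second difference of a paraboloid is exactly `2 |h|²`, and cutting
off at `0` only raises the values at `x + h` and `x - h`. The quadratic order in `h` makes the bound
integrable against the kernel for every `s < 1`; the Lipschitz bound alone would need `s < 1/2`. -/
lemma bump_second_difference_le (x₀ : Space N) (r : ℝ) (x h : Space N) :
    2 * bump x₀ r x - bump x₀ r (x + h) - bump x₀ r (x - h) ≤ 2 * min (‖h‖ ^ 2) (r ^ 2) := by
  have hp := parallelogram_law_with_norm ℝ (x - x₀) h
  have h1 : r ^ 2 - ‖x - x₀ + h‖ ^ 2 ≤ bump x₀ r (x + h) := by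
    rw [show x - x₀ + h = x + h - x₀ by abel]; exact le_max_left _ _
  have h2 : r ^ 2 - ‖x - x₀ - h‖ ^ 2 ≤ bump x₀ r (x - h) := by
    rw [show x - x₀ - h = x - h - x₀ by abel]; exact le_max_left _ _
  have h3 := bump_nonneg x₀ r (x + h)
  have h4 := bump_nonneg x₀ r (x - h)
  have h5 := bump_le x₀ r x
  rw [mul_min_of_nonneg _ _ (by norm_num : (0 : ℝ) ≤ 2)]
  refine le_min ?_ (by linarith)
  rcases le_total (r ^ 2 - ‖x - x₀‖ ^ 2) 0 with hx | hx
  · rw [show bump x₀ r x = 0 from max_eq_right hx]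
    nlinarith [sq_nonneg ‖h‖]
  · rw [show bump x₀ r x = r ^ 2 - ‖x - x₀‖ ^ 2 from max_eq_left hx]
    nlinarith

lemma memLp_bump (x₀ : Space N) (r : ℝ) : MemLp (bump x₀ r) 2 volume := by
  refine (continuous_bump x₀ r).memLp_of_hasCompactSupport ?_
  refine HasCompactSupport.intro (isCompact_closedBall x₀ |r|) fun x hx => ?_
  refine max_eq_right ?_
  rw [Metric.mem_closedBall, not_le, dist_eq_norm] at hx
  nlinarith [sq_abs r, abs_nonneg r]

lemma integrable_truncKernel_sub_mul_indicator (hN : 0 < N) (hs0 : 0 < s) (hs1 : s < 1) {r : ℝ}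
    (hr : 0 < r) (x₀ : Space N) :
    Integrable (fun z : Space N × Space N => (Metric.ball x₀ r).indicator (1 : Space N → ℝ) z.2 *
      truncKernel s r (z.1 - z.2)) := by
  have h1 : Integrable ((Metric.ball x₀ r).indicator (1 : Space N → ℝ)) :=
    (integrable_indicator_iff measurableSet_ball).2
      (integrableOn_const measure_ball_lt_top.ne)
  exact h1.convolution_integrand (ContinuousLinearMap.mul ℝ ℝ)
    (integrable_truncKernel hN hs0 hs1 hr)

/-- The integrand vanishes unless one of the two points lies in the ball. There the sum of the two
indicators is at least `1`, and the Lipschitz and sup bounds on the cap give `4 r²` times the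
truncated kernel. -/
lemma integrable_gagliardoIntegrand_bump (hN : 0 < N) (hs0 : 0 < s) (hs1 : s < 1) {r : ℝ}
    (hr : 0 < r) (x₀ : Space N) :
    Integrable (gagliardoIntegrand s (bump x₀ r) (bump x₀ r)) := by
  have h1 := integrable_truncKernel_sub_mul_indicator hN hs0 hs1 hr x₀
  have h2 := h1.swap
  refine ((h1.add h2).const_mul (4 * r ^ 2)).mono'
    (aestronglyMeasurable_gagliardoIntegrand s (continuous_bump x₀ r).aestronglyMeasurable)
    (Eventually.of_forall fun z => ?_)
  rw [Real.norm_of_nonneg (gagliardoIntegrand_self_nonneg _ _ _)]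
  simp only [Pi.add_apply, Function.comp_apply, Prod.fst_swap, Prod.snd_swap]
  have hsymm : truncKernel s r (z.2 - z.1) = truncKernel s r (z.1 - z.2) := by
    simp only [truncKernel, norm_sub_rev z.2 z.1]
  rw [hsymm, ← add_mul]
  by_cases hz : z.1 ∉ Metric.ball x₀ r ∧ z.2 ∉ Metric.ball x₀ r
  · simp [gagliardoIntegrand, bump_eq_zero hr.le hz.1, bump_eq_zero hr.le hz.2, hz.1, hz.2]
  have hone : (1 : ℝ) ≤ (Metric.ball x₀ r).indicator (1 : Space N → ℝ) z.2 +
      (Metric.ball x₀ r).indicator (1 : Space N → ℝ) z.1 := by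
    have h0 : ∀ y, 0 ≤ (Metric.ball x₀ r).indicator (1 : Space N → ℝ) y := fun y =>
      Set.indicator_nonneg (fun _ _ => zero_le_one) y
    rw [not_and_or, not_not, not_not] at hz
    rcases hz with hz | hz
    · have := h0 z.2
      rw [Set.indicator_of_mem hz, Pi.one_apply]
      linarith
    · have := h0 z.1
      rw [Set.indicator_of_mem hz, Pi.one_apply]
      linarith
  have hk := truncKernel_nonneg s r (z.1 - z.2)
  have hmain : gagliardoIntegrand s (bump x₀ r) (bump x₀ r) z ≤
      4 * r ^ 2 * truncKernel s r (z.1 - z.2) := by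
    unfold gagliardoIntegrand truncKernel
    rw [← mul_div_assoc]
    refine div_le_div_of_nonneg_right ?_ (by positivity)
    rw [mul_min_of_nonneg _ _ (by positivity), ← sq, ← sq_abs]
    have ha := abs_bump_sub_le hr.le x₀ z.1 z.2
    have hb : |bump x₀ r z.1 - bump x₀ r z.2| ≤ r ^ 2 :=
      abs_le.2 ⟨by linarith [bump_nonneg x₀ r z.1, bump_le x₀ r z.2],
        by linarith [bump_nonneg x₀ r z.2, bump_le x₀ r z.1]⟩
    have h0 := abs_nonneg (bump x₀ r z.1 - bump x₀ r z.2)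
    refine le_min ?_ ?_
    · calc |bump x₀ r z.1 - bump x₀ r z.2| ^ 2 ≤ (2 * r * ‖z.1 - z.2‖) ^ 2 := by gcongr
        _ = _ := by ring
    · calc |bump x₀ r z.1 - bump x₀ r z.2| ^ 2 ≤ (r ^ 2) ^ 2 := by gcongr
        _ ≤ 4 * r ^ 2 * r ^ 2 := by nlinarith [sq_nonneg (r ^ 2)]
  refine hmain.trans ?_
  have := mul_le_mul_of_nonneg_right hone hk
  nlinarith [sq_nonneg r]

lemma bump_mem_Hs0 (hN : 0 < N) (hs0 : 0 < s) (hs1 : s < 1) {r : ℝ}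
    (hr : 0 < r) {x₀ : Space N} (hΩ : Metric.ball x₀ r ⊆ Ω) :
    (memLp_bump x₀ r).toLp ∈ Hs0 Ω s := by
  have h0 := (memLp_bump x₀ r).coeFn_toLp
  refine ⟨?_, (integrable_congr (gagliardoIntegrand_congr s h0)).2
    (integrable_gagliardoIntegrand_bump hN hs0 hs1 hr x₀)⟩
  filter_upwards [h0] with x hx hxΩ
  rw [hx, bump_eq_zero hr.le fun h => hxΩ (hΩ h)]

/-- The fractional Laplacian of the paraboloid cap is weakly bounded above. -/
lemma gagliardo_bump_le (hN : 0 < N) (hs0 : 0 < s) (hs1 : s < 1) {r : ℝ}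
    (hr : 0 < r) (x₀ : Space N) {w : L2 N} (hw : w ∈ Hs0 Ω s) (hwi : Integrable w)
    (hw0 : ∀ᵐ x, 0 ≤ w x) :
    gagliardo s (bump x₀ r) w ≤ 2 * (∫ h : Space N, truncKernel s r h) * ∫ x, w x := by
  set η := bump x₀ r with hη
  have hF : Integrable (gagliardoIntegrand s η w) :=
    integrable_gagliardoIntegrand (continuous_bump x₀ r).aestronglyMeasurable
      (Lp.aestronglyMeasurable w) (integrable_gagliardoIntegrand_bump hN hs0 hs1 hr x₀) hw.2
  -- The shear `(x, h) ↦ (x, x + h)` allows integrating in `x` first, with the increment `h` fixed.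
  -- For fixed `h` each term can be translated separately, so no principal value is needed.
  have hT : MeasurePreserving (MeasurableEquiv.shearAddRight (Space N))
      (volume : Measure (Space N × Space N)) volume :=
    measurePreserving_prod_add volume volume
  have hint : Integrable (fun z : Space N × Space N =>
      gagliardoIntegrand s η w (z.1, z.1 + z.2)) := by
    exact (hT.integrable_comp_emb (MeasurableEquiv.measurableEmbedding _)).2 hF
  have heq : gagliardo s η w = ∫ h : Space N, ∫ x : Space N,
      gagliardoIntegrand s η w (x, x + h) := by
    unfold gagliardo
    rw [← hT.integral_comp' (gagliardoIntegrand s η w)]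
    exact integral_prod_symm _ hint
  rw [heq, mul_assoc, mul_comm (∫ h, truncKernel s r h), ← mul_assoc, ← integral_const_mul]
  refine integral_mono hint.integral_prod_right
    ((integrable_truncKernel hN hs0 hs1 hr).const_mul _) fun h => ?_
  have hbd : ∀ y, ‖η y‖ ≤ r ^ 2 := fun y => by
    rw [Real.norm_of_nonneg (bump_nonneg x₀ r y)]; exact bump_le x₀ r y
  have hηc : Continuous η := continuous_bump x₀ r
  have i1 : Integrable fun x => η x * w x :=
    hwi.bdd_mul hηc.aestronglyMeasurable (Eventually.of_forall hbd)
  have i2 : Integrable fun x => η (x + h) * w x :=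
    hwi.bdd_mul (hηc.comp (by fun_prop)).aestronglyMeasurable
      (Eventually.of_forall fun x => hbd _)
  have i3' : Integrable fun x => η (x - h) * w x :=
    hwi.bdd_mul (hηc.comp (by fun_prop)).aestronglyMeasurable
      (Eventually.of_forall fun x => hbd _)
  have i3 : Integrable fun x => η x * w (x + h) := by
    simpa using i3'.comp_add_right h
  have i4 : Integrable fun x => η (x + h) * w (x + h) := i1.comp_add_right h
  have e3 : ∫ x, η x * w (x + h) = ∫ x, η (x - h) * w x := by
    rw [← integral_add_right_eq_self (fun x => η (x - h) * w x) h]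
    simp
  have e4 : ∫ x, η (x + h) * w (x + h) = ∫ x, η x * w x :=
    integral_add_right_eq_self (fun x => η x * w x) h
  -- After translation `w` is evaluated at `x` only, and its coefficient is the second difference of
  -- the cap.
  have e : ∫ x, gagliardoIntegrand s η w (x, x + h) =
      (∫ x, (2 * η x - η (x + h) - η (x - h)) * w x) / ‖h‖ ^ ((N : ℝ) + 2 * s) := by
    have h1 : ∀ x, gagliardoIntegrand s η w (x, x + h) = (η x * w x - η x * w (x + h) -
        η (x + h) * w x + η (x + h) * w (x + h)) / ‖h‖ ^ ((N : ℝ) + 2 * s) := by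
      intro x
      simp only [gagliardoIntegrand, sub_add_cancel_left, norm_neg]
      ring
    simp only [h1]
    have i13 : Integrable fun x => η x * w x - η x * w (x + h) := i1.sub i3
    have i132 : Integrable fun x => η x * w x - η x * w (x + h) - η (x + h) * w x := i13.sub i2
    rw [integral_div, integral_add i132 i4, integral_sub i13 i2, integral_sub i1 i3, e3, e4]
    have h2 : ∀ x, (2 * η x - η (x + h) - η (x - h)) * w x =
        2 * (η x * w x) - η (x + h) * w x - η (x - h) * w x := fun x => by ring
    simp only [h2]
    have i12 : Integrable fun x => 2 * (η x * w x) - η (x + h) * w x := (i1.const_mul 2).sub i2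
    rw [integral_sub i12 i3', integral_sub (i1.const_mul 2) i2,
      integral_const_mul]
    ring
  simp only [e, truncKernel]
  rw [← mul_div_assoc]
  refine div_le_div_of_nonneg_right ?_ (by positivity)
  have hle : ∫ x, (2 * η x - η (x + h) - η (x - h)) * w x ≤
      ∫ x, 2 * min (‖h‖ ^ 2) (r ^ 2) * w x := by
    refine integral_mono_ae ?_ (hwi.const_mul _) ?_
    · have h2 : ∀ x, (2 * η x - η (x + h) - η (x - h)) * w x =
        2 * (η x * w x) - η (x + h) * w x - η (x - h) * w x := fun x => by ring
      simp only [h2]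
      exact ((i1.const_mul 2).sub i2).sub i3'
    · filter_upwards [hw0] with x hx
      exact mul_le_mul_of_nonneg_right (bump_second_difference_le x₀ r x h) hx
  rw [integral_const_mul] at hle
  linarith

end Bump

/-! ### Sobolev inequality from minimality, and control of the potential. -/

section Potential

variable {N : ℕ} {s p lam : ℝ} {Ω : Set (Space N)} {u : L2 N}

lemma energy_smul (Ω : Set (Space N)) (s lam c : ℝ) (v : L2 N) :
    energy Ω s lam (c • v) = c ^ 2 * energy Ω s lam v := by
  have h1 : gagliardo s (c • v : L2 N) (c • v : L2 N) = c ^ 2 * gagliardo s v v := by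
    rw [gagliardo_smul_left, gagliardo_comm, gagliardo_smul_left]
    ring
  have h2 : ∫ x in Ω, (c • v : L2 N) x ^ 2 = c ^ 2 * ∫ x in Ω, v x ^ 2 := by
    rw [← integral_const_mul]
    refine integral_congr_ae (ae_restrict_of_ae ?_)
    filter_upwards [Lp.coeFn_smul c v] with x hx
    rw [hx, Pi.smul_apply, smul_eq_mul, mul_pow]
  unfold energy
  rw [h1, h2]
  ring

lemma integral_abs_smul_rpow (Ω : Set (Space N)) (q : ℝ) {c : ℝ} (hc : 0 ≤ c) (v : L2 N) :
    ∫ x in Ω, |(c • v : L2 N) x| ^ q = c ^ q * ∫ x in Ω, |v x| ^ q := by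
  rw [← integral_const_mul]
  refine integral_congr_ae (ae_restrict_of_ae ?_)
  filter_upwards [Lp.coeFn_smul c v] with x hx
  rw [hx, Pi.smul_apply, smul_eq_mul, abs_mul, Real.mul_rpow (abs_nonneg _) (abs_nonneg _),
    abs_of_nonneg hc]

lemma abs_rpow_mul_self (hp : 1 < p) (u : L2 N) (x : Space N) :
    |u x| ^ (p - 1) * u x * u x = |u x| ^ (p + 1) := by
  rw [mul_assoc, ← abs_mul_abs_self, ← sq, ← Real.rpow_natCast,
    ← Real.rpow_add' (abs_nonneg _) (by push_cast; linarith)]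
  congr 1
  push_cast
  ring

lemma IsWeakSolution.energy_eq (hp : 1 < p) (hu : IsWeakSolution Ω s p lam u) :
    energy Ω s lam u = ∫ x in Ω, |u x| ^ (p + 1) := by
  have h := hu.2 u hu.1
  simp only [abs_rpow_mul_self hp] at h
  unfold energy
  rw [h]
  simp only [sq]
  ring

/-- A least energy solution has positive energy, and the minimality of its energy is a Sobolev
inequality. -/
lemma IsLeastEnergySolution.sobolev (hp : 1 < p) (hu : IsLeastEnergySolution Ω s p lam u) :
    0 < energy Ω s lam u ∧ ∃ m : ℝ, 0 < m ∧ ∀ v ∈ Hs0 Ω s, ∫ x in Ω, |v x| ^ (p + 1) ≠ 0 →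
      m * (∫ x in Ω, |v x| ^ (p + 1)) ^ (2 / (p + 1)) ≤ energy Ω s lam v := by
  obtain ⟨hsol, t, ht, w, ⟨hw, hw1, hmin⟩, rfl⟩ := hu
  have he := hsol.energy_eq hp
  rw [integral_abs_smul_rpow _ _ ht.le, hw1, mul_one] at he
  have hpos : 0 < energy Ω s lam (t • w) := by rw [he]; positivity
  refine ⟨hpos, energy Ω s lam w, ?_, fun v hv hI => ?_⟩
  · rw [energy_smul] at hpos
    exact pos_of_mul_pos_right hpos (sq_nonneg _)
  -- Scaling by `I^(-1/(p+1))` makes `v` admissible. Requiring `I ≠ 0` excludes a vanishing `v`, and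
  -- also a nonintegrable `|v|^(p+1)`, whose integral is `0` by convention; integrability is proved
  -- afterwards.
  · set I := ∫ x in Ω, |v x| ^ (p + 1) with hIdef
    have hI0 : 0 < I :=
      lt_of_le_of_ne (integral_nonneg fun x => Real.rpow_nonneg (abs_nonneg _) _) (Ne.symm hI)
    have hc : 0 ≤ I ^ (-(1 / (p + 1))) := by positivity
    have h := hmin (I ^ (-(1 / (p + 1))) • v) (Submodule.smul_mem _ _ hv) (by
      rw [integral_abs_smul_rpow _ _ hc, ← hIdef, ← Real.rpow_mul hI0.le,
        show -(1 / (p + 1)) * (p + 1) = -1 by field_simp, Real.rpow_neg_one,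
        inv_mul_cancel₀ hI])
    rw [energy_smul] at h
    have h2 : (I ^ (-(1 / (p + 1)))) ^ 2 = (I ^ (2 / (p + 1)))⁻¹ := by
      rw [← Real.rpow_natCast, ← Real.rpow_mul hI0.le, ← Real.rpow_neg hI0.le]
      congr 1
      push_cast
      ring
    rw [h2, inv_mul_eq_div, le_div_iff₀ (by positivity)] at h
    exact h

lemma setIntegral_sq_le (Ω : Set (Space N)) (v : L2 N) : ∫ x in Ω, v x ^ 2 ≤ ‖v‖ ^ 2 := by
  have h : ‖v‖ ^ 2 = ∫ x, v x ^ 2 := by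
    rw [← real_inner_self_eq_norm_sq, L2.inner_def]
    simp [sq]
  rw [h]
  exact setIntegral_le_integral (Lp.memLp v).integrable_sq
    (Eventually.of_forall fun x => sq_nonneg _)

lemma energy_le (Ω : Set (Space N)) (s lam : ℝ) (v : L2 N) :
    energy Ω s lam v ≤ gagliardo s v v + |lam| * ‖v‖ ^ 2 := by
  have h1 := setIntegral_sq_le Ω v
  have h0 : 0 ≤ ∫ x in Ω, v x ^ 2 := integral_nonneg fun x => sq_nonneg _
  unfold energy
  nlinarith [neg_abs_le lam, mul_le_mul_of_nonneg_left h1 (abs_nonneg lam),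
    mul_le_mul_of_nonneg_right (neg_abs_le lam) h0]

lemma lipschitzWith_clip (k : ℝ) : LipschitzWith 1 fun x : ℝ => max (-k) (min x k) :=
  (LipschitzWith.id.min_const k).const_max (-k)

/-- A Sobolev inequality for bounded functions extends to `H^s_0(Ω)` by truncation. -/
lemma integrableOn_abs_rpow (hΩ : volume Ω ≠ ⊤) (hp : 1 < p) {m : ℝ} (hm : 0 < m)
    (h : ∀ v ∈ Hs0 Ω s, ∫ x in Ω, |v x| ^ (p + 1) ≠ 0 →
      m * (∫ x in Ω, |v x| ^ (p + 1)) ^ (2 / (p + 1)) ≤ energy Ω s lam v)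
    {v : L2 N} (hv : v ∈ Hs0 Ω s) : IntegrableOn (fun x => |v x| ^ (p + 1)) Ω := by
  set E := gagliardo s v v + |lam| * ‖v‖ ^ 2 with hE
  have hE0 : 0 ≤ E := add_nonneg (gagliardo_self_nonneg _ _) (by positivity)
  set A := (E / m) ^ ((p + 1) / 2) with hA
  have hmeas : ∀ v : L2 N, AEStronglyMeasurable (fun x => |v x| ^ (p + 1))
      (volume.restrict Ω) := fun v =>
    ((Lp.stronglyMeasurable v).measurable.abs.pow_const _).aestronglyMeasurable
  have hclip0 : ∀ k : ℕ, max (-(k : ℝ)) (min 0 (k : ℝ)) = 0 := fun k => by simp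
  set c : ℕ → L2 N := fun k => (lipschitzWith_clip (k : ℝ)).compLp (hclip0 k) v with hc
  have hcae : ∀ᵐ x, ∀ k : ℕ, c k x = max (-(k : ℝ)) (min (v x) k) :=
    ae_all_iff.2 fun k => (lipschitzWith_clip (k : ℝ)).coeFn_compLp (hclip0 k) v
  have hfin : IsFiniteMeasure (volume.restrict Ω) := ⟨by simpa using hΩ.lt_top⟩
  have hint : ∀ k, IntegrableOn (fun x => |c k x| ^ (p + 1)) Ω := by
    intro k
    refine (integrable_const ((k : ℝ) ^ (p + 1))).mono' (hmeas _) (ae_restrict_of_ae ?_)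
    filter_upwards [hcae] with x hx
    rw [Real.norm_of_nonneg (by positivity), hx k]
    refine Real.rpow_le_rpow (abs_nonneg _) (abs_le.2 ⟨le_max_left _ _, ?_⟩) (by linarith)
    exact max_le (by linarith [(Nat.cast_nonneg k : (0 : ℝ) ≤ k)]) (min_le_right _ _)
  -- Truncation increases neither the seminorm nor the `L²` norm, so the bound `A` does not depend
  -- on the level `k`. It comes from inverting the exponent `2 / (p + 1)`.
  have hbound : ∀ k, ∫ x in Ω, |c k x| ^ (p + 1) ≤ A := by
    intro k
    by_cases h0 : ∫ x in Ω, |c k x| ^ (p + 1) = 0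
    · rw [h0]; positivity
    have hg := gagliardo_comp_le (lipschitzWith_clip (k : ℝ)) (hclip0 k) hv
    have hn := (lipschitzWith_clip (k : ℝ)).norm_compLp_le (hclip0 k) v
    rw [NNReal.coe_one, one_mul] at hn
    have h1 := h (c k) hg.1 h0
    have h2 : energy Ω s lam (c k) ≤ E := by
      refine (energy_le _ _ _ _).trans (add_le_add hg.2 ?_)
      gcongr
    have hI0 : 0 ≤ ∫ x in Ω, |c k x| ^ (p + 1) :=
      integral_nonneg fun x => Real.rpow_nonneg (abs_nonneg _) _
    have h3 : (∫ x in Ω, |c k x| ^ (p + 1)) ^ (2 / (p + 1)) ≤ E / m := by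
      rw [le_div_iff₀ hm, mul_comm]
      exact h1.trans h2
    have h4 := Real.rpow_le_rpow (by positivity) h3 (by positivity : 0 ≤ (p + 1) / 2)
    rwa [← Real.rpow_mul hI0, show 2 / (p + 1) * ((p + 1) / 2) = 1 by field_simp,
      Real.rpow_one] at h4
  refine ⟨hmeas v, ?_⟩
  rw [hasFiniteIntegral_iff_ofReal (Eventually.of_forall fun x =>
    Real.rpow_nonneg (abs_nonneg _) _)]
  refine lt_of_le_of_lt ?_ (ENNReal.ofReal_lt_top (r := A))
  -- At each point the truncations equal `v` as soon as `k ≥ |v x|`, so Fatou transfers the uniform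
  -- bound to `v`.
  calc ∫⁻ x in Ω, ENNReal.ofReal (|v x| ^ (p + 1))
      = ∫⁻ x in Ω, liminf (fun k => ENNReal.ofReal (|c k x| ^ (p + 1))) atTop := by
        refine lintegral_congr_ae (ae_restrict_of_ae ?_)
        filter_upwards [hcae] with x hx
        refine (Tendsto.liminf_eq (tendsto_const_nhds.congr' ?_)).symm
        obtain ⟨k₀, hk₀⟩ := exists_nat_ge |v x|
        filter_upwards [eventually_ge_atTop k₀] with k hk
        have hk' : |v x| ≤ k := hk₀.trans (by exact_mod_cast hk)
        rw [hx k, min_eq_left (abs_le.1 hk').2, max_eq_right (abs_le.1 hk').1]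
    _ ≤ liminf (fun k => ∫⁻ x in Ω, ENNReal.ofReal (|c k x| ^ (p + 1))) atTop :=
        lintegral_liminf_le' fun k => (hmeas _).aemeasurable.ennreal_ofReal
    _ ≤ ENNReal.ofReal A := by
        refine liminf_le_of_le (by isBoundedDefault) fun b hb => ?_
        obtain ⟨k, hk⟩ := hb.exists
        refine hk.trans ?_
        rw [← ofReal_integral_eq_lintegral_ofReal (hint k)
          (Eventually.of_forall fun x => Real.rpow_nonneg (abs_nonneg _) _)]
        exact ENNReal.ofReal_le_ofReal (hbound k)

/-- Each factor is at most the maximum of the three numbers, and the exponents add up to `p + 1`. -/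
lemma rpow_mul_mul_le (hp : 1 < p) {a b c : ℝ} (ha : 0 ≤ a) (hb : 0 ≤ b) (hc : 0 ≤ c) :
    a ^ (p - 1) * b * c ≤ a ^ (p + 1) + b ^ (p + 1) + c ^ (p + 1) := by
  set M := max a (max b c) with hM
  have hM0 : 0 ≤ M := ha.trans (le_max_left _ _)
  have h1 : a ^ (p - 1) * b * c ≤ M ^ (p - 1) * M * M := by
    have h1 : a ^ (p - 1) ≤ M ^ (p - 1) :=
      Real.rpow_le_rpow ha (le_max_left _ _) (by linarith)
    have h2 : b ≤ M := (le_max_left _ _).trans (le_max_right _ _)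
    have h3 : c ≤ M := (le_max_right _ _).trans (le_max_right _ _)
    gcongr
  have h2 : M ^ (p - 1) * M * M = M ^ (p + 1) := by
    rw [mul_assoc, ← sq, ← Real.rpow_natCast, ← Real.rpow_add' hM0 (by push_cast; linarith)]
    congr 1
    push_cast
    ring
  have h3 : M ^ (p + 1) ≤ a ^ (p + 1) + b ^ (p + 1) + c ^ (p + 1) := by
    have ha' := Real.rpow_nonneg ha (p + 1)
    have hb' := Real.rpow_nonneg hb (p + 1)
    have hc' := Real.rpow_nonneg hc (p + 1)
    rcases max_choice a (max b c) with h | h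
    · rw [hM, h]; linarith
    · rcases max_choice b c with h' | h'
      · rw [hM, h, h']; linarith
      · rw [hM, h, h']; linarith
  linarith

lemma integrableOn_potential (hp : 1 < p)
    (hL : ∀ v ∈ Hs0 Ω s, IntegrableOn (fun x => |v x| ^ (p + 1)) Ω)
    {u v w : L2 N} (hu : u ∈ Hs0 Ω s) (hv : v ∈ Hs0 Ω s) (hw : w ∈ Hs0 Ω s) :
    IntegrableOn (fun x => |u x| ^ (p - 1) * v x * w x) Ω := by
  refine (((hL u hu).add (hL v hv)).add (hL w hw)).mono' ?_ (Eventually.of_forall fun x => ?_)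
  · exact ((((Lp.stronglyMeasurable u).measurable.abs.pow_const _).mul
      (Lp.stronglyMeasurable v).measurable).mul
      (Lp.stronglyMeasurable w).measurable).aestronglyMeasurable
  · rw [norm_mul, norm_mul, Real.norm_of_nonneg (by positivity)]
    exact rpow_mul_mul_le hp (abs_nonneg _) (abs_nonneg _) (abs_nonneg _)

/-- The potential `|u|^(p-1)` is an infinitesimal perturbation of the Gagliardo form. -/
lemma exists_potential_le (hp : 1 < p) {m : ℝ} (hm : 0 < m)
    (h : ∀ v ∈ Hs0 Ω s, ∫ x in Ω, |v x| ^ (p + 1) ≠ 0 →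
      m * (∫ x in Ω, |v x| ^ (p + 1)) ^ (2 / (p + 1)) ≤ energy Ω s lam v)
    (hL : ∀ v ∈ Hs0 Ω s, IntegrableOn (fun x => |v x| ^ (p + 1)) Ω)
    (hu : u ∈ Hs0 Ω s) {ε : ℝ} (hε : 0 < ε) :
    ∃ C : ℝ, 0 ≤ C ∧ ∀ v ∈ Hs0 Ω s,
      ∫ x in Ω, |u x| ^ (p - 1) * v x * v x ≤ ε * gagliardo s v v + C * ‖v‖ ^ 2 := by
  have hmu : Measurable fun x => |u x| := (Lp.stronglyMeasurable u).measurable.abs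
  have hS : ∀ k : ℕ, MeasurableSet {x | (k : ℝ) < |u x|} := fun k =>
    measurableSet_lt measurable_const hmu
  have htail : Tendsto (fun k : ℕ => ∫ x in Ω, {x | (k : ℝ) < |u x|}.indicator
      (fun x => |u x| ^ (p + 1)) x) atTop (𝓝 0) := by
    have : (0 : ℝ) = ∫ x in Ω, (0 : ℝ) := by simp
    rw [this]
    refine tendsto_integral_of_dominated_convergence (fun x => |u x| ^ (p + 1))
      (fun k => ((hmu.pow_const _).indicator (hS k)).aestronglyMeasurable) (hL u hu)
      (fun k => Eventually.of_forall fun x => ?_) (Eventually.of_forall fun x => ?_)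
    · refine (norm_indicator_le_norm_self _ _).trans ?_
      rw [Real.norm_of_nonneg (by positivity)]
    · refine tendsto_const_nhds.congr' ?_
      obtain ⟨k₀, hk₀⟩ := exists_nat_ge |u x|
      filter_upwards [eventually_ge_atTop k₀] with k hk
      have hk' : |u x| ≤ k := hk₀.trans (by exact_mod_cast hk)
      rw [Set.indicator_of_notMem (by simpa using hk')]
  have htail' : Tendsto (fun k : ℕ => (∫ x in Ω, {x | (k : ℝ) < |u x|}.indicator
      (fun x => |u x| ^ (p + 1)) x) ^ ((p - 1) / (p + 1))) atTop (𝓝 0) := by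
    have hpos : 0 < (p - 1) / (p + 1) := div_pos (by linarith) (by linarith)
    have := htail.rpow_const (p := (p - 1) / (p + 1)) (Or.inr hpos.le)
    rwa [Real.zero_rpow hpos.ne'] at this
  -- The level `k` makes the `L^((p+1)/(p-1))` norm of the tail `f` of the potential smaller than `ε
  -- m`; Hölder and the Sobolev inequality then bound its contribution by `ε` times the energy
  -- bound.
  obtain ⟨k, hk⟩ := (htail'.eventually_lt_const (mul_pos hε hm)).exists
  set f : Space N → ℝ := {x | (k : ℝ) < |u x|}.indicator fun x => |u x| ^ (p - 1) with hf
  have hf0 : ∀ x, 0 ≤ f x := fun x =>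
    Set.indicator_nonneg (fun x _ => Real.rpow_nonneg (abs_nonneg _) _) x
  have hfm : Measurable f := (hmu.pow_const _).indicator (hS k)
  have hfq : ∀ x, f x ^ ((p + 1) / (p - 1)) =
      {x | (k : ℝ) < |u x|}.indicator (fun x => |u x| ^ (p + 1)) x := by
    intro x
    have hp' : p - 1 ≠ 0 := by linarith
    by_cases hx : (k : ℝ) < |u x|
    · rw [hf, Set.indicator_of_mem (by exact hx), Set.indicator_of_mem (by exact hx),
        ← Real.rpow_mul (abs_nonneg _)]
      congr 1
      field_simp
    · rw [hf, Set.indicator_of_notMem (by exact hx), Set.indicator_of_notMem (by exact hx),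
        Real.zero_rpow (div_pos (by linarith) (by linarith)).ne']
  have hle : ∀ x, |u x| ^ (p - 1) ≤ (k : ℝ) ^ (p - 1) + f x := by
    intro x
    by_cases hx : (k : ℝ) < |u x|
    · rw [hf, Set.indicator_of_mem (by exact hx)]
      linarith [Real.rpow_nonneg (Nat.cast_nonneg k : (0 : ℝ) ≤ k) (p - 1)]
    · rw [hf, Set.indicator_of_notMem (by exact hx), add_zero]
      exact Real.rpow_le_rpow (abs_nonneg _) (not_lt.1 hx) (by linarith)
  have hconj : ((p + 1) / (p - 1)).HolderConjugate ((p + 1) / 2) := by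
    rw [Real.holderConjugate_iff]
    refine ⟨(one_lt_div (by linarith)).2 (by linarith), ?_⟩
    have hp' : p - 1 ≠ 0 := by linarith
    have hp'' : p + 1 ≠ 0 := by linarith
    field_simp
    ring
  have hmemf : MemLp f (ENNReal.ofReal ((p + 1) / (p - 1))) (volume.restrict Ω) := by
    rw [← integrable_norm_rpow_iff hfm.aestronglyMeasurable
      (ENNReal.ofReal_pos.2 (div_pos (by linarith) (by linarith))).ne' ENNReal.ofReal_ne_top,
      ENNReal.toReal_ofReal (div_nonneg (by linarith) (by linarith))]
    simp only [Real.norm_of_nonneg (hf0 _), hfq]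
    exact (hL u hu).indicator (hS k)
  -- The first term bounds the potential where `|u| ≤ k`; the second pays for replacing the energy
  -- by the Gagliardo form.
  refine ⟨(k : ℝ) ^ (p - 1) + ε * |lam|, by positivity, fun v hv => ?_⟩
  have hvm : Measurable v := (Lp.stronglyMeasurable v).measurable
  have hvq : ∀ x, (v x ^ 2) ^ ((p + 1) / 2) = |v x| ^ (p + 1) := by
    intro x
    rw [← sq_abs, ← Real.rpow_natCast, ← Real.rpow_mul (abs_nonneg _)]
    congr 1
    push_cast
    ring
  have hmemv : MemLp (fun x => v x ^ 2) (ENNReal.ofReal ((p + 1) / 2)) (volume.restrict Ω) := by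
    rw [← integrable_norm_rpow_iff (hvm.pow_const 2).aestronglyMeasurable
      (ENNReal.ofReal_pos.2 (by linarith)).ne' ENNReal.ofReal_ne_top,
      ENNReal.toReal_ofReal (by linarith)]
    simp only [Real.norm_of_nonneg (sq_nonneg _), hvq]
    exact hL v hv
  have hholder := integral_mul_le_Lp_mul_Lq_of_nonneg hconj (Eventually.of_forall hf0)
    (Eventually.of_forall fun x => sq_nonneg (v x)) hmemf hmemv
  simp only [hfq, hvq] at hholder
  have hq1 : 1 / ((p + 1) / (p - 1)) = (p - 1) / (p + 1) := by rw [one_div_div]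
  have hq2 : 1 / ((p + 1) / 2) = 2 / (p + 1) := by rw [one_div_div]
  rw [hq1, hq2] at hholder
  have hfv : IntegrableOn (fun x => f x * v x ^ 2) Ω := by
    refine (integrableOn_potential hp hL hu hv hv).mono'
      (hfm.mul (hvm.pow_const 2)).aestronglyMeasurable (Eventually.of_forall fun x => ?_)
    rw [Real.norm_of_nonneg (mul_nonneg (hf0 x) (sq_nonneg _)), mul_assoc, ← sq]
    refine mul_le_mul_of_nonneg_right ?_ (sq_nonneg _)
    exact Set.indicator_le_self' (fun x _ => Real.rpow_nonneg (abs_nonneg _) _) x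
  have hv2 : IntegrableOn (fun x => v x ^ 2) Ω := (Lp.memLp v).integrable_sq.integrableOn
  have hsob : m * (∫ x in Ω, |v x| ^ (p + 1)) ^ (2 / (p + 1)) ≤
      gagliardo s v v + |lam| * ‖v‖ ^ 2 := by
    by_cases h0 : ∫ x in Ω, |v x| ^ (p + 1) = 0
    · rw [h0, Real.zero_rpow (div_pos two_pos (by linarith)).ne', mul_zero]
      exact add_nonneg (gagliardo_self_nonneg _ _) (by positivity)
    · exact (h v hv h0).trans (energy_le _ _ _ _)
  have hI0 : 0 ≤ (∫ x in Ω, |v x| ^ (p + 1)) ^ (2 / (p + 1)) :=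
    Real.rpow_nonneg (integral_nonneg fun x => Real.rpow_nonneg (abs_nonneg _) _) _
  calc ∫ x in Ω, |u x| ^ (p - 1) * v x * v x
      ≤ ∫ x in Ω, ((k : ℝ) ^ (p - 1) * v x ^ 2 + f x * v x ^ 2) := by
        refine integral_mono (integrableOn_potential hp hL hu hv hv) ((hv2.const_mul _).add hfv)
          fun x => ?_
        simp only
        rw [mul_assoc, ← sq, ← add_mul]
        exact mul_le_mul_of_nonneg_right (hle x) (sq_nonneg _)
    _ = (k : ℝ) ^ (p - 1) * (∫ x in Ω, v x ^ 2) + ∫ x in Ω, f x * v x ^ 2 := by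
        rw [integral_add (hv2.const_mul _) hfv, integral_const_mul]
    _ ≤ (k : ℝ) ^ (p - 1) * ‖v‖ ^ 2 +
        ε * m * (∫ x in Ω, |v x| ^ (p + 1)) ^ (2 / (p + 1)) := by
        refine add_le_add (mul_le_mul_of_nonneg_left (setIntegral_sq_le Ω v) (by positivity))
          (hholder.trans (mul_le_mul_of_nonneg_right hk.le hI0))
    _ ≤ ε * gagliardo s v v + ((k : ℝ) ^ (p - 1) + ε * |lam|) * ‖v‖ ^ 2 := by
        have := mul_le_mul_of_nonneg_left hsob hε.le
        nlinarith

end Potential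

/-! ### Minimizers of Rayleigh quotients. -/

section Rayleigh

variable {E : Type*} [NormedAddCommGroup E] [InnerProductSpace ℝ E] {H : Submodule ℝ E}

/-- A minimizer of a quadratic form under a norm constraint satisfies the Euler-Lagrange
equation. -/
lemma euler_lagrange {a : LinearMap.BilinForm ℝ H} (ha : ∀ v w, a v w = a w v)
    {F : Submodule ℝ E} {μ : ℝ} (hmin : ∀ w : H, (w : E) ∈ F → μ * ‖w‖ ^ 2 ≤ a w w)
    {v : H} (hvF : (v : E) ∈ F) (hv : a v v = μ * ‖v‖ ^ 2) {w : H} (hw : (w : E) ∈ F) :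
    a v w = μ * inner ℝ (v : E) (w : E) := by
  set K := a w w - μ * ‖w‖ ^ 2 with hK
  set L := a v w - μ * inner ℝ (v : E) (w : E) with hL
  have hK0 : 0 ≤ K := sub_nonneg.2 (hmin w hw)
  have hquad : ∀ t : ℝ, 0 ≤ 2 * t * L + t ^ 2 * K := by
    intro t
    have h := hmin (v + t • w) (by
      simpa using Submodule.add_mem _ hvF (Submodule.smul_mem _ t hw))
    have hn : ‖v + t • w‖ ^ 2 = ‖v‖ ^ 2 + 2 * t * inner ℝ (v : E) (w : E) + t ^ 2 * ‖w‖ ^ 2 := by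
      rw [norm_add_sq_real, inner_smul_right, norm_smul, mul_pow, Real.norm_eq_abs, sq_abs,
        Submodule.coe_inner]
      ring
    have hq : a (v + t • w) (v + t • w) = a v v + 2 * t * a v w + t ^ 2 * a w w := by
      simp only [map_add, map_smul, LinearMap.add_apply, LinearMap.smul_apply, smul_eq_mul,
        ha w v]
      ring
    rw [hn, hq, hv] at h
    rw [hK, hL]
    nlinarith
  -- The optimal choice would be `-L / K`, but `K` may vanish. With `K + 1` the quadratic still
  -- takes the value `-L² (K + 2) / (K + 1)²`, which forces `L = 0`.
  have h := hquad (-L / (K + 1))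
  have hK1 : (0 : ℝ) < K + 1 := by linarith
  have h2 : 2 * (-L / (K + 1)) * L + (-L / (K + 1)) ^ 2 * K =
      -(L ^ 2 * (K + 2)) / (K + 1) ^ 2 := by
    field_simp
    ring
  rw [h2, le_div_iff₀ (by positivity), zero_mul] at h
  have hL0 : L ^ 2 = 0 := by nlinarith [sq_nonneg L, mul_nonneg (sq_nonneg L) hK0]
  have := pow_eq_zero_iff (two_ne_zero) |>.1 hL0
  linarith

/-- The Rayleigh quotient of `a` attains its minimum on `H ⊓ F` when `a` is comparable with a
closed nonnegative form `b` whose form domain embeds compactly. -/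
lemma exists_rayleigh_minimizer {a b : LinearMap.BilinForm ℝ H} {C : ℝ}
    (hb : ∀ v, 0 ≤ b v v)
    (hlow : ∀ v : H, b v v ≤ 2 * a v v + C * ‖v‖ ^ 2)
    (hup : ∀ v : H, a v v ≤ b v v + C * ‖v‖ ^ 2)
    (hclosed : ∀ (v : ℕ → H) (x : E) (M : ℝ), (∀ n, b (v n) (v n) ≤ M) →
      Tendsto (fun n => (v n : E)) atTop (𝓝 x) → ∃ hx : x ∈ H, b ⟨x, hx⟩ ⟨x, hx⟩ ≤ M)
    (hcomp : ∀ (v : ℕ → H) (M : ℝ), (∀ n, b (v n) (v n) ≤ M) → (∀ n, ‖v n‖ ≤ 1) →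
      ∃ (x : E) (ns : ℕ → ℕ), StrictMono ns ∧ Tendsto (fun n => (v (ns n) : E)) atTop (𝓝 x))
    {F : Submodule ℝ E} (hF : IsClosed (F : Set E)) {v₀ : H} (hv₀ : v₀ ≠ 0)
    (hv₀F : (v₀ : E) ∈ F) :
    ∃ v : H, (v : E) ∈ F ∧ ‖v‖ = 1 ∧ ∀ w : H, (w : E) ∈ F → a v v * ‖w‖ ^ 2 ≤ a w w := by
  have hsmul : ∀ (c : ℝ) (w : H), a (c • w) (c • w) = c ^ 2 * a w w := fun c w => by
    simp only [map_smul, LinearMap.smul_apply, smul_eq_mul]; ring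
  have hpar : ∀ v w : H, a (v + w) (v + w) + a (v - w) (v - w) = 2 * a v v + 2 * a w w :=
    fun v w => by
      simp only [map_add, map_sub, LinearMap.add_apply, LinearMap.sub_apply]; ring
  set S : Set ℝ := {r | ∃ v : H, (v : E) ∈ F ∧ ‖v‖ = 1 ∧ a v v = r} with hS
  have hunit : ∀ w : H, (w : E) ∈ F → w ≠ 0 → a w w / ‖w‖ ^ 2 ∈ S := by
    intro w hw hw0
    refine ⟨‖w‖⁻¹ • w, by simpa using Submodule.smul_mem _ _ hw, ?_, ?_⟩
    · rw [norm_smul, norm_inv, norm_norm, inv_mul_cancel₀ (norm_ne_zero_iff.2 hw0)]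
    · rw [hsmul, inv_pow, div_eq_inv_mul]
  have hbdd : BddBelow S := by
    refine ⟨-C / 2, ?_⟩
    rintro r ⟨v, -, hv1, rfl⟩
    have h1 := hlow v
    have h2 := hb v
    rw [hv1] at h1
    linarith
  set μ := sInf S with hμ
  have hmin : ∀ w : H, (w : E) ∈ F → μ * ‖w‖ ^ 2 ≤ a w w := by
    intro w hw
    by_cases hw0 : w = 0
    · simp [hw0]
    · have h1 := csInf_le hbdd (hunit w hw hw0)
      rwa [le_div_iff₀ (pow_pos (norm_pos_iff.2 hw0) 2)] at h1
  obtain ⟨r, -, hr, hrS⟩ := exists_seq_tendsto_sInf ⟨_, hunit v₀ hv₀F hv₀⟩ hbdd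
  choose v' hv'F hv'1 hv'r using hrS
  obtain ⟨B, hB⟩ := hr.bddAbove_range
  have hv'b : ∀ n, b (v' n) (v' n) ≤ 2 * B + C := by
    intro n
    have h1 := hlow (v' n)
    have h2 : r n ≤ B := hB ⟨n, rfl⟩
    rw [hv'1, hv'r] at h1
    linarith
  obtain ⟨x, ns, hns, hx⟩ := hcomp v' _ hv'b fun n => (hv'1 n).le
  set v : ℕ → H := fun n => v' (ns n) with hv
  have hq : Tendsto (fun n => a (v n) (v n)) atTop (𝓝 μ) := by
    have := hr.comp hns.tendsto_atTop
    refine this.congr fun n => ?_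
    rw [Function.comp_apply, hv, hv'r]
  obtain ⟨hxH, -⟩ := hclosed v x _ (fun n => hv'b (ns n)) hx
  set X : H := ⟨x, hxH⟩ with hX
  have hvX : Tendsto v atTop (𝓝 X) := tendsto_subtype_rng.2 hx
  have hXF : (X : E) ∈ F := hF.mem_of_tendsto hx (Eventually.of_forall fun n => hv'F (ns n))
  have hX1 : ‖X‖ = 1 := by
    refine tendsto_nhds_unique hvX.norm ?_
    simp only [hv, hv'1]
    exact tendsto_const_nhds
  -- Parallelogram law for `a`, with the sum `v i + v j` bounded below by minimality: a minimizing
  -- sequence that converges in norm is also Cauchy for `b`.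
  have hdiff : ∀ i j, b (v i - v j) (v i - v j) ≤
      4 * (a (v i) (v i) - μ) + 4 * (a (v j) (v j) - μ) + (2 * μ + C) * ‖v i - v j‖ ^ 2 := by
    intro i j
    have h1 := hlow (v i - v j)
    have h2 := hpar (v i) (v j)
    have h3 := hmin (v i + v j) (by simpa using Submodule.add_mem _ (hv'F _) (hv'F _))
    have h4 := parallelogram_law_with_norm ℝ (v i) (v j)
    have h5 : ‖v i‖ = 1 := hv'1 _
    have h6 : ‖v j‖ = 1 := hv'1 _
    rw [h5, h6] at h4
    have h7 : ‖v i + v j‖ ^ 2 = 4 - ‖v i - v j‖ ^ 2 := by nlinarith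
    rw [h7] at h3
    linarith
  have hsub : Tendsto (fun i => b (v i - X) (v i - X)) atTop (𝓝 0) := by
    refine Metric.tendsto_atTop.2 fun ε hε => ?_
    have e1 : ∀ᶠ n in atTop, 4 * (a (v n) (v n) - μ) < ε / 4 := by
      have : Tendsto (fun n => 4 * (a (v n) (v n) - μ)) atTop (𝓝 0) := by
        simpa using (hq.sub_const μ).const_mul 4
      exact this.eventually_lt_const (by positivity)
    have e2 : ∀ᶠ n : ℕ × ℕ in atTop, (2 * μ + C) * ‖v n.1 - v n.2‖ ^ 2 < ε / 4 := by
      have h1 : Tendsto (fun n : ℕ × ℕ => v n.1 - v n.2) atTop (𝓝 0) := by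
        rw [← prod_atTop_atTop_eq]
        simpa using (hvX.comp tendsto_fst).sub (hvX.comp tendsto_snd)
      have h2 := ((h1.norm.pow 2).const_mul (2 * μ + C))
      rw [norm_zero, zero_pow two_ne_zero, mul_zero] at h2
      exact h2.eventually_lt_const (by positivity)
    obtain ⟨n₁, hn₁⟩ := eventually_atTop.1 e1
    obtain ⟨⟨k, l⟩, hkl⟩ := eventually_atTop.1 e2
    set n₀ := max n₁ (max k l) with hn₀
    refine ⟨n₀, fun i hi => ?_⟩
    rw [Real.dist_eq, sub_zero, abs_of_nonneg (hb _)]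
    -- Closedness of `b` is applied to `v i - v j` as `j → ∞`. The shift by `n₀` makes the bound,
    -- three terms of size `ε / 4`, hold along the whole sequence.
    obtain ⟨hx', hle⟩ := hclosed (fun j => v i - v (j + n₀)) (x := (v i : E) - x) (3 * ε / 4)
      (fun j => by
        have h1 := hn₁ i (by omega)
        have h2 := hn₁ (j + n₀) (by omega)
        have h3 := hkl (i, j + n₀) ⟨by simp only; omega, by simp only; omega⟩
        have h4 := hdiff i (j + n₀)
        simp only at h3
        linarith)
      (by
        have := (tendsto_add_atTop_iff_nat n₀).2 hx
        simpa using tendsto_const_nhds.sub this)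
    have heq : (⟨(v i : E) - x, hx'⟩ : H) = v i - X := Subtype.ext (by simp [hX])
    rw [heq] at hle
    linarith
  refine ⟨X, hXF, hX1, fun w hw => ?_⟩
  -- Parallelogram law for `v i` and `v i - X`: their difference is `X`, and their sum is bounded
  -- below by minimality. Only the upper bound on `a (v i - X) (v i - X)` is needed, not continuity
  -- of `a`.
  have hle : a X X ≤ μ := by
    have hnorm : Tendsto (fun i => ‖v i - X‖ ^ 2) atTop (𝓝 0) := by
      have := ((hvX.sub_const X).norm.pow 2)
      simpa using this
    have hnorm2 : Tendsto (fun i => ‖v i + (v i - X)‖ ^ 2) atTop (𝓝 1) := by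
      have := ((hvX.add (hvX.sub_const X)).norm.pow 2)
      simpa [hX1] using this
    have hlim : Tendsto (fun i => 2 * a (v i) (v i) + 2 * (b (v i - X) (v i - X) +
        C * ‖v i - X‖ ^ 2) - μ * ‖v i + (v i - X)‖ ^ 2) atTop
        (𝓝 (2 * μ + 2 * (0 + C * 0) - μ * 1)) :=
      ((hq.const_mul 2).add ((hsub.add (hnorm.const_mul C)).const_mul 2)).sub
        (hnorm2.const_mul μ)
    rw [show 2 * μ + 2 * (0 + C * 0) - μ * 1 = μ by ring] at hlim
    refine ge_of_tendsto' hlim fun i => ?_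
    have h1 := hpar (v i) (v i - X)
    rw [sub_sub_cancel] at h1
    have h2 := hmin (v i + (v i - X)) (by
      simpa using Submodule.add_mem _ (hv'F _) (Submodule.sub_mem _ (hv'F _) hXF))
    have h3 := hup (v i - X)
    linarith
  exact (mul_le_mul_of_nonneg_right hle (sq_nonneg _)).trans (hmin w hw)

end Rayleigh

/-! ### Nonlocal strong maximum principle. -/

section MaximumPrinciple

variable {N : ℕ} {s : ℝ} {Ω : Set (Space N)}

lemma Hs0.integrable_coe (hΩ : MeasurableSet Ω) (hΩt : volume Ω ≠ ⊤) {v : L2 N}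
    (hv : v ∈ Hs0 Ω s) : Integrable v := by
  have hfin : IsFiniteMeasure (volume.restrict Ω) := ⟨by simpa using hΩt.lt_top⟩
  have h1 : IntegrableOn v Ω := (Lp.memLp v).restrict Ω |>.integrable (by norm_num)
  refine ((integrable_indicator_iff hΩ).2 h1).congr ?_
  filter_upwards [hv.1] with x hx
  by_cases h : x ∈ Ω
  · simp [h]
  · simp [h, hx h]

/-- Splitting into positive and negative parts, the right-hand side is `(a⁺ - b⁺)² + a⁺ b⁻ + a⁻ b⁺`.
The cross term `a⁺ b⁻` is the nonlocal interaction that drives the strong maximum principle. -/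
lemma mul_sub_max_ge (a b : ℝ) :
    max a 0 * max (-b) 0 ≤ (a - b) * (max a 0 - max b 0) := by
  rcases le_total a 0 with ha | ha <;> rcases le_total b 0 with hb | hb <;>
    simp only [max_eq_left, max_eq_right, ha, hb, neg_nonneg, neg_nonpos] <;> nlinarith

lemma mul_sub_max_nonneg (a b : ℝ) : 0 ≤ (a - b) * (max a 0 - max b 0) :=
  (mul_nonneg (le_max_right _ _) (le_max_right _ _)).trans (mul_sub_max_ge a b)

lemma lipschitzWith_max_zero : LipschitzWith 1 fun x : ℝ => max x 0 :=
  LipschitzWith.id.max_const 0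

/-- The interaction of the positive part of `h` with a set on which `h` is negative. -/
lemma gagliardo_posPart_ge (hs0 : 0 < s) {h : L2 N} (hh : h ∈ Hs0 Ω s)
    (hwi : Integrable (lipschitzWith_max_zero.compLp (max_self 0) h : L2 N))
    {A : Set (Space N)} (hA : MeasurableSet A) (hAΩ : A ⊆ Ω) (hAt : volume A ≠ ⊤)
    {D : ℝ} (hD : ∀ x ∈ Ω, ∀ y ∈ Ω, ‖x - y‖ ≤ D) {δ : ℝ} (hδ : 0 < δ)
    (hneg : ∀ᵐ x, x ∈ A → h x ≤ -δ) :
    δ / D ^ ((N : ℝ) + 2 * s) * volume.real A *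
        ∫ x, (lipschitzWith_max_zero.compLp (max_self 0) h : L2 N) x ≤
      gagliardo s h (lipschitzWith_max_zero.compLp (max_self 0) h : L2 N) := by
  set w : L2 N := lipschitzWith_max_zero.compLp (max_self 0) h with hw
  have hwH : w ∈ Hs0 Ω s := (gagliardo_comp_le lipschitzWith_max_zero (max_self 0) hh).1
  have hwae : ∀ᵐ x, w x = max (h x) 0 := lipschitzWith_max_zero.coeFn_compLp (max_self 0) h
  have h1A : Integrable (A.indicator (fun _ => δ / D ^ ((N : ℝ) + 2 * s)) : Space N → ℝ) :=
    (integrable_indicator_iff hA).2 (integrableOn_const hAt)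
  have hprod := hwi.mul_prod h1A
  have heq : δ / D ^ ((N : ℝ) + 2 * s) * volume.real A * ∫ x, w x =
      ∫ z : Space N × Space N, w z.1 *
        (A.indicator (fun _ => δ / D ^ ((N : ℝ) + 2 * s)) z.2 : ℝ) := by
    rw [show (∫ z : Space N × Space N, w z.1 *
        (A.indicator (fun _ => δ / D ^ ((N : ℝ) + 2 * s)) z.2 : ℝ)) = _ from
      integral_prod_mul (w : Space N → ℝ) _, integral_indicator hA, setIntegral_const,
      smul_eq_mul]
    ring
  rw [heq]
  refine integral_mono_ae hprod (Hs0.integrable hh hwH) ?_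
  have q1 {P : Space N → Prop} (hP : ∀ᵐ x, P x) : ∀ᵐ z : Space N × Space N, P z.1 :=
    Measure.quasiMeasurePreserving_fst.ae hP
  have q2 {P : Space N → Prop} (hP : ∀ᵐ x, P x) : ∀ᵐ z : Space N × Space N, P z.2 :=
    Measure.quasiMeasurePreserving_snd.ae hP
  filter_upwards [q1 hwae, q2 hwae, q1 hwH.1, q2 hneg] with z hz1 hz2 hz3 hz4
  have hpow : 0 ≤ ‖z.1 - z.2‖ ^ ((N : ℝ) + 2 * s) := by positivity
  have hnonneg : 0 ≤ gagliardoIntegrand s h w z := by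
    refine div_nonneg ?_ hpow
    rw [hz1, hz2]
    exact mul_sub_max_nonneg _ _
  by_cases hy : z.2 ∈ A
  · rw [Set.indicator_of_mem hy]
    rcases eq_or_ne (w z.1) 0 with h0 | h0
    · rwa [h0, zero_mul]
    have hx : z.1 ∈ Ω := by
      by_contra hx
      exact h0 (hz3 hx)
    have hhy := hz4 hy
    -- On the diagonal the quotient is `0` by convention, so distinct points are needed: `w` is
    -- nonzero at the first point and vanishes at the second, where `h` is negative.
    have hne : z.1 ≠ z.2 := by
      intro he
      rw [he, hz2, max_eq_right (by linarith)] at h0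
      exact h0 rfl
    have hn : 0 < ‖z.1 - z.2‖ := norm_pos_iff.2 (sub_ne_zero.2 hne)
    have hw0 : 0 ≤ w z.1 := by rw [hz1]; exact le_max_right _ _
    unfold gagliardoIntegrand
    rw [← mul_div_assoc]
    refine div_le_div₀ ?_ ?_ (Real.rpow_pos_of_pos hn _)
      (Real.rpow_le_rpow hn.le (hD _ hx _ (hAΩ hy)) (by positivity))
    · rw [hz1, hz2]; exact mul_sub_max_nonneg _ _
    · have hm := mul_sub_max_ge (h z.1) (h z.2)
      rw [← hz1, ← hz2] at hm
      refine le_trans ?_ hm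
      exact mul_le_mul_of_nonneg_left (le_trans (by linarith) (le_max_left _ _)) hw0
  · rw [Set.indicator_of_notMem hy, mul_zero]
    exact hnonneg

/-- Weak supersolutions of `(-Δ)^s φ + C φ ≥ 0` dominate a small paraboloid cap. -/
lemma exists_bump_le (hN : 0 < N) (hs0 : 0 < s) (hs1 : s < 1) (hΩo : IsOpen Ω)
    (hΩb : Bornology.IsBounded Ω) {φ : L2 N} (hφ : φ ∈ Hs0 Ω s) (hφ0 : ∀ᵐ x, 0 ≤ φ x)
    (hne : φ ≠ 0) {C : ℝ} (hC : 0 ≤ C)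
    (hsuper : ∀ w ∈ Hs0 Ω s, (∀ᵐ x, 0 ≤ w x) → 0 ≤ gagliardo s φ w + C * ∫ x, φ x * w x)
    {x₀ : Space N} {r : ℝ} (hr : 0 < r) (hball : Metric.ball x₀ r ⊆ Ω) :
    ∃ c : ℝ, 0 < c ∧ ∀ᵐ x, c * bump x₀ r x ≤ φ x := by
  have hΩm : MeasurableSet Ω := hΩo.measurableSet
  have hΩt : volume Ω ≠ ⊤ := hΩb.measure_lt_top.ne
  have hφm : Measurable φ := (Lp.stronglyMeasurable φ).measurable
  -- Since `φ` is nonnegative and nonzero, some level set has positive measure; it becomes the set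
  -- `A` that interacts with the positive part of `c η - φ`.
  obtain ⟨n, hn⟩ : ∃ n : ℕ, volume {x | x ∈ Ω ∧ 1 / ((n : ℝ) + 1) ≤ φ x} ≠ 0 := by
    by_contra! hall
    refine hne ((Lp.eq_zero_iff_ae_eq_zero).2 ?_)
    have h1 : ∀ᵐ x, ∀ n : ℕ, ¬ (x ∈ Ω ∧ 1 / ((n : ℝ) + 1) ≤ φ x) :=
      ae_all_iff.2 fun n => measure_eq_zero_iff_ae_notMem.1 (hall n)
    filter_upwards [h1, hφ0, hφ.1] with x h2 h3 h4
    by_cases hx : x ∈ Ω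
    · refine le_antisymm ?_ h3
      by_contra! hpos
      obtain ⟨n, hn⟩ := exists_nat_one_div_lt hpos
      exact h2 n ⟨hx, hn.le⟩
    · exact h4 hx
  set d : ℝ := 1 / ((n : ℝ) + 1) with hd
  have hd0 : 0 < d := by positivity
  set A := {x | x ∈ Ω ∧ d ≤ φ x} with hA
  have hAm : MeasurableSet A := hΩm.inter (measurableSet_le measurable_const hφm)
  have hAΩ : A ⊆ Ω := fun x hx => hx.1
  have hAt : volume A ≠ ⊤ := ((measure_mono hAΩ).trans_lt hΩt.lt_top).ne
  have hApos : 0 < volume.real A := ENNReal.toReal_pos hn hAt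
  obtain ⟨D, hD0, hD⟩ : ∃ D : ℝ, 0 < D ∧ ∀ x ∈ Ω, ∀ y ∈ Ω, ‖x - y‖ ≤ D := by
    refine ⟨Metric.diam Ω + 1, by linarith [Metric.diam_nonneg (s := Ω)], fun x hx y hy => ?_⟩
    have := Metric.dist_le_diam_of_mem hΩb hx hy
    rw [dist_eq_norm] at this
    linarith
  set κ := d / 2 / D ^ ((N : ℝ) + 2 * s) * volume.real A with hκ
  have hκ0 : 0 < κ := by positivity
  set T := 2 * ∫ h : Space N, truncKernel s r h with hT
  have hT0 : 0 ≤ T := mul_nonneg two_pos.le (integral_nonneg (truncKernel_nonneg s r))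
  -- The first condition keeps `c η - φ ≤ -d / 2` on `A`; the second makes the interaction `κ` beat
  -- both the fractional Laplacian of the cap and the zero-order term.
  obtain ⟨c, hc0, hcr, hcκ⟩ : ∃ c : ℝ, 0 < c ∧ c * r ^ 2 ≤ d / 2 ∧ c * (T + C * r ^ 2) < κ := by
    have hr2 : 0 < r ^ 2 := by positivity
    have hK : 0 < T + C * r ^ 2 + 1 := by positivity
    refine ⟨min (d / 2 / r ^ 2) (κ / (T + C * r ^ 2 + 1)), by positivity, ?_, ?_⟩
    · rw [← le_div_iff₀ hr2]
      exact min_le_left _ _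
    · calc _ ≤ κ / (T + C * r ^ 2 + 1) * (T + C * r ^ 2) :=
            mul_le_mul_of_nonneg_right (min_le_right _ _) (by positivity)
        _ < κ / (T + C * r ^ 2 + 1) * (T + C * r ^ 2 + 1) :=
            mul_lt_mul_of_pos_left (by linarith) (by positivity)
        _ = κ := by field_simp
  refine ⟨c, hc0, ?_⟩
  set η : L2 N := (memLp_bump x₀ r).toLp with hη
  have hηae : η =ᵐ[volume] bump x₀ r := (memLp_bump x₀ r).coeFn_toLp
  have hηH : η ∈ Hs0 Ω s := bump_mem_Hs0 hN hs0 hs1 hr hball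
  set h : L2 N := c • η - φ with hh
  have hhH : h ∈ Hs0 Ω s := Submodule.sub_mem _ (Submodule.smul_mem _ _ hηH) hφ
  have hhae : ∀ᵐ x, h x = c * bump x₀ r x - φ x := by
    filter_upwards [Lp.coeFn_sub (c • η) φ, Lp.coeFn_smul c η, hηae] with x h1 h2 h3
    rw [hh, h1, Pi.sub_apply, h2, Pi.smul_apply, h3, smul_eq_mul]
  set w : L2 N := lipschitzWith_max_zero.compLp (max_self 0) h with hw
  have hwae : ∀ᵐ x, w x = max (h x) 0 := lipschitzWith_max_zero.coeFn_compLp (max_self 0) h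
  have hwH : w ∈ Hs0 Ω s := (gagliardo_comp_le lipschitzWith_max_zero (max_self 0) hhH).1
  have hwi : Integrable w := Hs0.integrable_coe hΩm hΩt hwH
  have hw0 : ∀ᵐ x, 0 ≤ w x := by
    filter_upwards [hwae] with x hx
    rw [hx]; exact le_max_right _ _
  have hcross := gagliardo_posPart_ge hs0 hhH hwi hAm hAΩ hAt hD (half_pos hd0) (by
    filter_upwards [hhae] with x hx hxA
    rw [hx]
    have h1 := mul_le_mul_of_nonneg_left (bump_le x₀ r x) hc0.le
    have h2 : d ≤ φ x := hxA.2
    linarith)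
  rw [← hκ, ← hw] at hcross
  have hcap : gagliardo s η w ≤ T * ∫ x, w x := by
    rw [gagliardo_congr s hηae (EventuallyEq.refl _ _)]
    exact gagliardo_bump_le hN hs0 hs1 hr x₀ hwH hwi hw0
  have hφw : ∫ x, φ x * w x ≤ c * r ^ 2 * ∫ x, w x := by
    rw [← integral_const_mul]
    have hφwi : Integrable fun x => φ x * w x := by
      have := L2.integrable_inner (𝕜 := ℝ) w φ
      simpa using this
    refine integral_mono_ae hφwi (hwi.const_mul _) ?_
    filter_upwards [hwae, hhae] with x h1 h2
    rcases le_total (h x) 0 with h3 | h3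
    · rw [h1, max_eq_right h3, mul_zero, mul_zero]
    · refine mul_le_mul_of_nonneg_right ?_ (by rw [h1]; exact le_max_right _ _)
      have h4 := mul_le_mul_of_nonneg_left (bump_le x₀ r x) hc0.le
      linarith
  have hsplit : gagliardo s φ w = c * gagliardo s η w - gagliardo s h w := by
    have h1 : φ = c • η + (-1 : ℝ) • h := by rw [hh]; simp
    have h2 : gagliardo s φ w = gagliardo s (c • η + (-1 : ℝ) • h : L2 N) w := by rw [← h1]
    rw [h2, gagliardo_add_left (Submodule.smul_mem _ _ hηH) (Submodule.smul_mem _ _ hhH) hwH,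
      gagliardo_smul_left, gagliardo_smul_left]
    ring
  have hw_int0 : 0 ≤ ∫ x, w x := integral_nonneg_of_ae hw0
  -- Testing with `w = (c η - φ)⁺` yields `0 ≤ (c (T + C r²) - κ) ∫ w`, whose coefficient is
  -- negative.
  have hint : ∫ x, w x = 0 := by
    have h1 := hsuper w hwH hw0
    rw [hsplit] at h1
    have h2 := mul_le_mul_of_nonneg_left hcap hc0.le
    have h3 := mul_le_mul_of_nonneg_left hφw hC
    by_contra hne0
    have hpos : 0 < ∫ x, w x := lt_of_le_of_ne hw_int0 (Ne.symm hne0)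
    have h4 := mul_lt_mul_of_pos_right hcκ hpos
    nlinarith
  have hzero := (integral_eq_zero_iff_of_nonneg_ae hw0 hwi).1 hint
  filter_upwards [hzero, hwae, hhae] with x h1 h2 h3
  rw [h2, Pi.zero_apply] at h1
  have := max_eq_right_iff.1 h1
  linarith

/-- Strong maximum principle. -/
lemma strictlyPositiveIn_of_supersolution (hN : 0 < N) (hs0 : 0 < s) (hs1 : s < 1)
    (hΩo : IsOpen Ω) (hΩb : Bornology.IsBounded Ω) {φ : L2 N} (hφ : φ ∈ Hs0 Ω s)
    (hφ0 : ∀ᵐ x, 0 ≤ φ x) (hne : φ ≠ 0) {C : ℝ} (hC : 0 ≤ C)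
    (hsuper : ∀ w ∈ Hs0 Ω s, (∀ᵐ x, 0 ≤ w x) → 0 ≤ gagliardo s φ w + C * ∫ x, φ x * w x) :
    StrictlyPositiveIn Ω φ := by
  intro K hK hKΩ
  refine hK.induction_on (p := fun S => ∃ c : ℝ, 0 < c ∧ ∀ᵐ x : Space N, x ∈ S → c ≤ φ x)
    ⟨1, one_pos, by simp⟩ ?_ ?_ ?_
  · rintro S S' hSS' ⟨c, hc, h⟩
    exact ⟨c, hc, h.mono fun x hx hxS => hx (hSS' hxS)⟩
  · rintro S S' ⟨c, hc, h⟩ ⟨c', hc', h'⟩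
    refine ⟨min c c', lt_min hc hc', ?_⟩
    filter_upwards [h, h'] with x hx hx' hxS
    rcases hxS with hxS | hxS
    · exact (min_le_left _ _).trans (hx hxS)
    · exact (min_le_right _ _).trans (hx' hxS)
  · intro x₀ hx₀
    obtain ⟨r, hr, hball⟩ := Metric.isOpen_iff.1 hΩo x₀ (hKΩ hx₀)
    obtain ⟨c, hc, h⟩ := exists_bump_le hN hs0 hs1 hΩo hΩb hφ hφ0 hne hC hsuper hr hball
    -- On the ball of half the radius the cap is at least `r² - r² / 4`.
    refine ⟨Metric.ball x₀ (r / 2), mem_nhdsWithin_of_mem_nhds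
      (Metric.ball_mem_nhds _ (by positivity)), c * (3 * r ^ 2 / 4), by positivity, ?_⟩
    filter_upwards [h] with x hx hxb
    refine le_trans (mul_le_mul_of_nonneg_left ?_ hc.le) hx
    refine le_trans ?_ (le_max_left _ _)
    rw [Metric.mem_ball, dist_eq_norm] at hxb
    nlinarith [norm_nonneg (x - x₀)]

/-- A small closed ball around each point of `Ω` carries a positive lower bound, so the exceptional
set is locally null, hence null. -/
lemma StrictlyPositiveIn.ae_pos (hΩo : IsOpen Ω) {v : L2 N} (hv : StrictlyPositiveIn Ω v) :
    ∀ᵐ x, x ∈ Ω → 0 < v x := by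
  have hnull : volume {x | x ∈ Ω ∧ v x ≤ 0} = 0 := by
    refine measure_null_of_locally_null _ fun x hx => ?_
    obtain ⟨r, hr, hball⟩ := Metric.nhds_basis_closedBall.mem_iff.1 (hΩo.mem_nhds hx.1)
    obtain ⟨c, hc, h⟩ := hv _ (isCompact_closedBall x r) hball
    refine ⟨{y | y ∈ Metric.closedBall x r ∧ v y ≤ 0}, ?_, ?_⟩
    · filter_upwards [mem_nhdsWithin_of_mem_nhds (Metric.closedBall_mem_nhds x hr),
        self_mem_nhdsWithin] with y hy hy'
      exact ⟨hy, hy'.2⟩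
    · refine measure_eq_zero_iff_ae_notMem.2 ?_
      filter_upwards [h] with y hy hy'
      exact absurd (hy hy'.1) (not_le.2 (hy'.2.trans_lt hc))
  filter_upwards [measure_eq_zero_iff_ae_notMem.1 hnull] with x hx hxΩ
  exact not_le.1 fun h => hx ⟨hxΩ, h⟩

end MaximumPrinciple

/-! ### Abstract gap between the first two eigenvalues. -/

section Spectrum

variable {E : Type*} [NormedAddCommGroup E] [InnerProductSpace ℝ E] {H : Submodule ℝ E}

/-- A bilinear form from a symmetric function that is linear in the first variable. -/
noncomputable def bilinFormOfSymm (f : H → H → ℝ) (symm : ∀ v w, f v w = f w v)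
    (add : ∀ v v' w, f (v + v') w = f v w + f v' w)
    (smul : ∀ (c : ℝ) v w, f (c • v) w = c * f v w) : LinearMap.BilinForm ℝ H :=
  LinearMap.mk₂ ℝ f add smul
    (fun v w w' => by rw [symm, add, symm w, symm w'])
    (fun c v w => by rw [symm, smul, symm w, smul_eq_mul])

/-- If the lowest eigenvalue `μ₁` is simple with eigenvector `φ`, then a minimizer of the form on
the orthogonal complement of `φ` is an eigenvector for a larger eigenvalue `μ₂`, and eigenvectors
for eigenvalues below `μ₂` are multiples of `φ`. -/
lemma second_eigenvalue {a : LinearMap.BilinForm ℝ H} (ha : ∀ v w, a v w = a w v) {μ₁ μ₂ : ℝ}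
    (hmin : ∀ w : H, μ₁ * ‖w‖ ^ 2 ≤ a w w) {φ : H} (hφ0 : φ ≠ 0)
    (hφ : ∀ w : H, a φ w = μ₁ * inner ℝ (φ : E) (w : E))
    (hsimple : ∀ ψ : H, (∀ w : H, a ψ w = μ₁ * inner ℝ (ψ : E) (w : E)) → ∃ c : ℝ, ψ = c • φ)
    {v : H} (hvφ : inner ℝ (φ : E) (v : E) = 0) (hv0 : v ≠ 0) (hv : a v v = μ₂ * ‖v‖ ^ 2)
    (hmin₂ : ∀ w : H, inner ℝ (φ : E) (w : E) = 0 → μ₂ * ‖w‖ ^ 2 ≤ a w w) :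
    (∀ w : H, a v w = μ₂ * inner ℝ (v : E) (w : E)) ∧ μ₁ < μ₂ ∧
      ∀ (ν : ℝ) (w : H), w ≠ 0 → (∀ z : H, a w z = ν * inner ℝ (w : E) (z : E)) →
        ν < μ₂ → ∃ c : ℝ, w = c • φ := by
  have hφn : (0 : ℝ) < inner ℝ (φ : E) (φ : E) := by
    rw [← Submodule.coe_inner, real_inner_self_eq_norm_sq]
    exact pow_pos (norm_pos_iff.2 hφ0) 2
  have hF : ∀ w : H, (w : E) ∈ (ℝ ∙ (φ : E))ᗮ ↔ inner ℝ (φ : E) (w : E) = 0 := fun w =>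
    Submodule.mem_orthogonal_singleton_iff_inner_right
  -- Minimality tests only against the complement of `φ`. In the direction `φ` both sides vanish, by
  -- symmetry and the equation for `φ`.
  have heig : ∀ w : H, a v w = μ₂ * inner ℝ (v : E) (w : E) := by
    intro w
    set c := inner ℝ (φ : E) (w : E) / inner ℝ (φ : E) (φ : E) with hc
    have hw : inner ℝ (φ : E) ((w - c • φ : H) : E) = 0 := by
      rw [Submodule.coe_sub, Submodule.coe_smul, inner_sub_right, inner_smul_right, hc,
        div_mul_cancel₀ _ hφn.ne', sub_self]
    have h1 := euler_lagrange ha (F := (ℝ ∙ (φ : E))ᗮ) (fun w hw => hmin₂ w ((hF w).1 hw))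
      ((hF v).2 hvφ) hv ((hF _).2 hw)
    have h2 : a v φ = 0 := by rw [ha, hφ, hvφ, mul_zero]
    have hvφ' : inner ℝ (v : E) (φ : E) = 0 := by rw [real_inner_comm, hvφ]
    rw [map_sub, map_smul, h2, smul_zero, sub_zero, Submodule.coe_sub, Submodule.coe_smul,
      inner_sub_right, inner_smul_right, hvφ', mul_zero, sub_zero] at h1
    exact h1
  have hvn : 0 < ‖v‖ ^ 2 := pow_pos (norm_pos_iff.2 hv0) 2
  refine ⟨heig, lt_of_le_of_ne ?_ ?_, ?_⟩
  · have := hmin v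
    rw [hv] at this
    exact le_of_mul_le_mul_right this hvn
  · intro heq
    rw [← heq] at heig
    obtain ⟨c, rfl⟩ := hsimple v heig
    rw [Submodule.coe_smul, inner_smul_right] at hvφ
    rcases mul_eq_zero.1 hvφ with hc | hc
    · exact hv0 (by rw [hc, zero_smul])
    · exact hφn.ne' hc
  · intro ν w hw0 hw hν
    by_cases hνμ : ν = μ₁
    · subst hνμ
      exact hsimple w hw
    exfalso
    -- Eigenvectors for distinct eigenvalues are orthogonal, so the Rayleigh bound on the complement
    -- applies to `w` and contradicts `ν < μ₂`.
    have h1 : inner ℝ (φ : E) (w : E) = 0 := by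
      have h2 := hw φ
      rw [ha, hφ, real_inner_comm (φ : E) (w : E)] at h2
      have h3 : (ν - μ₁) * inner ℝ (φ : E) (w : E) = 0 := by linarith
      exact (mul_eq_zero.1 h3).resolve_left (sub_ne_zero.2 hνμ)
    have h2 := hmin₂ w h1
    rw [hw w, ← Submodule.coe_inner, real_inner_self_eq_norm_sq] at h2
    exact absurd (le_of_mul_le_mul_right h2 (pow_pos (norm_pos_iff.2 hw0) 2)) (not_le.2 hν)

end Spectrum

/-! ### The linearized form: sign and simplicity of the ground state. -/

section Linearized

variable {N : ℕ} {s p lam : ℝ} {Ω : Set (Space N)} {u : L2 N}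

/-- The Gagliardo scalar product on `H^s_0(Ω)`. -/
noncomputable def gagliardoForm (Ω : Set (Space N)) (s : ℝ) :
    LinearMap.BilinForm ℝ (Hs0 Ω s) :=
  bilinFormOfSymm (fun v w => gagliardo s (v : L2 N) (w : L2 N))
    (fun _ _ => gagliardo_comm _ _ _)
    (fun v v' w => gagliardo_add_left v.2 v'.2 w.2)
    (fun c _ _ => gagliardo_smul_left c _ _)

/-- The quadratic form of the linearized problem. -/
noncomputable def linearizedForm (lam : ℝ) (hp : 1 < p)
    (hL : ∀ v ∈ Hs0 Ω s, IntegrableOn (fun x => |v x| ^ (p + 1)) Ω) (hu : u ∈ Hs0 Ω s) :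
    LinearMap.BilinForm ℝ (Hs0 Ω s) :=
  bilinFormOfSymm (fun v w => gagliardo s (v : L2 N) (w : L2 N) -
      p * (∫ x in Ω, |u x| ^ (p - 1) * (v : L2 N) x * (w : L2 N) x) -
      lam * inner ℝ (v : L2 N) (w : L2 N))
    (fun _ _ => by
      rw [gagliardo_comm, real_inner_comm]
      simp only [mul_right_comm])
    (fun v v' w => by
      have h1 : ∫ x in Ω, |u x| ^ (p - 1) * ((v + v' : Hs0 Ω s) : L2 N) x * (w : L2 N) x =
          (∫ x in Ω, |u x| ^ (p - 1) * (v : L2 N) x * (w : L2 N) x) +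
            ∫ x in Ω, |u x| ^ (p - 1) * (v' : L2 N) x * (w : L2 N) x := by
        rw [← integral_add (integrableOn_potential hp hL hu v.2 w.2)
          (integrableOn_potential hp hL hu v'.2 w.2)]
        refine integral_congr_ae (ae_restrict_of_ae ?_)
        filter_upwards [Lp.coeFn_add (v : L2 N) (v' : L2 N)] with x hx
        rw [Submodule.coe_add, hx, Pi.add_apply]
        ring
      rw [h1, Submodule.coe_add, gagliardo_add_left v.2 v'.2 w.2, inner_add_left]
      ring)
    (fun c v w => by
      have h1 : ∫ x in Ω, |u x| ^ (p - 1) * ((c • v : Hs0 Ω s) : L2 N) x * (w : L2 N) x =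
          c * ∫ x in Ω, |u x| ^ (p - 1) * (v : L2 N) x * (w : L2 N) x := by
        rw [← integral_const_mul]
        refine integral_congr_ae (ae_restrict_of_ae ?_)
        filter_upwards [Lp.coeFn_smul c (v : L2 N)] with x hx
        rw [Submodule.coe_smul, hx, Pi.smul_apply, smul_eq_mul]
        ring
      rw [h1, Submodule.coe_smul, gagliardo_smul_left, real_inner_smul_left]
      ring)

lemma gagliardoForm_apply (v w : Hs0 Ω s) :
    gagliardoForm Ω s v w = gagliardo s (v : L2 N) (w : L2 N) := rfl

variable (hp : 1 < p) (hL : ∀ v ∈ Hs0 Ω s, IntegrableOn (fun x => |v x| ^ (p + 1)) Ω)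
  (hu : u ∈ Hs0 Ω s)

lemma linearizedForm_apply (v w : Hs0 Ω s) :
    linearizedForm lam hp hL hu v w = gagliardo s (v : L2 N) (w : L2 N) -
      p * (∫ x in Ω, |u x| ^ (p - 1) * (v : L2 N) x * (w : L2 N) x) -
      lam * inner ℝ (v : L2 N) (w : L2 N) := rfl

lemma linearizedForm_comm (v w : Hs0 Ω s) :
    linearizedForm lam hp hL hu v w = linearizedForm lam hp hL hu w v := by
  rw [linearizedForm_apply, linearizedForm_apply, gagliardo_comm, real_inner_comm]
  simp only [mul_right_comm]

lemma isEigenfunction_iff (hΩ : MeasurableSet Ω) {μ : ℝ} (v : Hs0 Ω s) :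
    IsEigenfunction Ω s p lam u μ v ↔ v ≠ 0 ∧ ∀ w : Hs0 Ω s,
      linearizedForm lam hp hL hu v w = μ * inner ℝ (v : L2 N) (w : L2 N) := by
  simp only [linearizedForm_apply, ← Hs0.setIntegral_eq v.2 hΩ]
  exact ⟨fun h => ⟨fun h0 => h.2.1 (by rw [h0]; rfl), fun w => h.2.2 w w.2⟩,
    fun h => ⟨v.2, fun h0 => h.1 (Subtype.ext h0), fun w hw => h.2 ⟨w, hw⟩⟩⟩

/-- Taking absolute values is a contraction, so the seminorm does not grow, while the potential and
the `L²` terms depend only on `v²`. -/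
lemma linearizedForm_abs_le (v : Hs0 Ω s) : ∃ v' : Hs0 Ω s,
    (∀ᵐ x, (v' : L2 N) x = |(v : L2 N) x|) ∧ ‖v'‖ = ‖v‖ ∧
    linearizedForm lam hp hL hu v' v' ≤ linearizedForm lam hp hL hu v v := by
  have hlip : LipschitzWith 1 fun x : ℝ => |x| := lipschitzWith_one_norm
  have hg := gagliardo_comp_le hlip abs_zero v.2
  have hae : ∀ᵐ x, hlip.compLp abs_zero (v : L2 N) x = |(v : L2 N) x| :=
    hlip.coeFn_compLp abs_zero (v : L2 N)
  have hnorm : ‖hlip.compLp abs_zero (v : L2 N)‖ = ‖(v : L2 N)‖ := by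
    have hab : ∀ᵐ x, ‖hlip.compLp abs_zero (v : L2 N) x‖ = ‖(v : L2 N) x‖ := by
      filter_upwards [hae] with x hx
      rw [hx, Real.norm_eq_abs, Real.norm_eq_abs, abs_abs]
    exact le_antisymm (Lp.norm_le_norm_of_ae_le (hab.mono fun x hx => hx.le))
      (Lp.norm_le_norm_of_ae_le (hab.mono fun x hx => hx.ge))
  refine ⟨⟨_, hg.1⟩, hae, hnorm, ?_⟩
  have hpot : ∫ x in Ω, |u x| ^ (p - 1) * hlip.compLp abs_zero (v : L2 N) x *
      hlip.compLp abs_zero (v : L2 N) x =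
      ∫ x in Ω, |u x| ^ (p - 1) * (v : L2 N) x * (v : L2 N) x := by
    refine integral_congr_ae (ae_restrict_of_ae ?_)
    filter_upwards [hae] with x hx
    rw [hx, mul_assoc, abs_mul_abs_self, mul_assoc]
  rw [linearizedForm_apply, linearizedForm_apply]
  simp only [real_inner_self_eq_norm_sq]
  rw [hpot, hnorm]
  linarith [hg.2]

/-- Against nonnegative test functions the potential term has a good sign, so `v` is a supersolution
with zero-order coefficient `|lam + μ|`. No bound on the potential is needed. -/
lemma strictlyPositiveIn_of_nonneg (hN : 0 < N) (hs0 : 0 < s) (hs1 : s < 1)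
    (hΩo : IsOpen Ω) (hΩb : Bornology.IsBounded Ω) {μ : ℝ} {v : Hs0 Ω s} (hv0 : v ≠ 0)
    (hnn : ∀ᵐ x, 0 ≤ (v : L2 N) x)
    (hv : ∀ w : Hs0 Ω s, linearizedForm lam hp hL hu v w = μ * inner ℝ (v : L2 N) (w : L2 N)) :
    StrictlyPositiveIn Ω (v : L2 N) := by
  refine strictlyPositiveIn_of_supersolution hN hs0 hs1 hΩo hΩb v.2 hnn
    (fun h0 => hv0 (Subtype.ext h0)) (abs_nonneg (lam + μ)) fun w hw hw0 => ?_
  have h1 := hv ⟨w, hw⟩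
  rw [linearizedForm_apply] at h1
  have h2 : inner ℝ (v : L2 N) w = ∫ x, (v : L2 N) x * w x := by
    rw [L2.inner_def]
    simp [mul_comm]
  have h3 : 0 ≤ ∫ x in Ω, |u x| ^ (p - 1) * (v : L2 N) x * w x := by
    refine integral_nonneg_of_ae (ae_restrict_of_ae ?_)
    filter_upwards [hnn, hw0] with x h1 h2
    exact mul_nonneg (mul_nonneg (Real.rpow_nonneg (abs_nonneg _) _) h1) h2
  have h4 : 0 ≤ ∫ x, (v : L2 N) x * w x := by
    refine integral_nonneg_of_ae ?_
    filter_upwards [hnn, hw0] with x h1 h2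
    exact mul_nonneg h1 h2
  simp only [h2] at h1
  have h5 := mul_le_mul_of_nonneg_right (neg_abs_le (lam + μ)) h4
  have h6 : 0 ≤ p * ∫ x in Ω, |u x| ^ (p - 1) * (v : L2 N) x * w x :=
    mul_nonneg (by linarith) h3
  linarith

/-- Eigenfunctions of the lowest eigenvalue have a strict sign. -/
lemma strictlyPositiveIn_or_neg (hN : 0 < N) (hs0 : 0 < s) (hs1 : s < 1)
    (hΩo : IsOpen Ω) (hΩb : Bornology.IsBounded Ω) {μ : ℝ}
    (hmin : ∀ w : Hs0 Ω s, μ * ‖w‖ ^ 2 ≤ linearizedForm lam hp hL hu w w)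
    {v : Hs0 Ω s} (hv0 : v ≠ 0)
    (hv : ∀ w : Hs0 Ω s, linearizedForm lam hp hL hu v w = μ * inner ℝ (v : L2 N) (w : L2 N)) :
    StrictlyPositiveIn Ω (v : L2 N) ∨ StrictlyPositiveIn Ω ((-v : Hs0 Ω s) : L2 N) := by
  obtain ⟨z, hz, hzn, hzle⟩ := linearizedForm_abs_le (lam := lam) hp hL hu v
  have hvv : linearizedForm lam hp hL hu v v = μ * ‖v‖ ^ 2 := by
    rw [hv, ← Submodule.coe_inner, real_inner_self_eq_norm_sq]
  have hzeig : ∀ w : Hs0 Ω s,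
      linearizedForm lam hp hL hu z w = μ * inner ℝ (z : L2 N) (w : L2 N) := fun w =>
    euler_lagrange (linearizedForm_comm hp hL hu) (F := ⊤) (fun w _ => hmin w) trivial
      (le_antisymm (by rw [hzn, ← hvv]; exact hzle) (hmin z)) trivial
  have hz0 : z ≠ 0 := by rw [← norm_ne_zero_iff, hzn, norm_ne_zero_iff]; exact hv0
  have hzpos : StrictlyPositiveIn Ω (z : L2 N) :=
    strictlyPositiveIn_of_nonneg hp hL hu hN hs0 hs1 hΩo hΩb hz0
      (by filter_upwards [hz] with x hx; rw [hx]; exact abs_nonneg _) hzeig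
  have hadd := Lp.coeFn_add (v : L2 N) (z : L2 N)
  -- Here `z = |v|`, and `v + z` is a nonnegative solution of the same equation: either it vanishes
  -- and `v = -|v|`, or it is strictly positive, which forces `v = |v|`.
  by_cases hy0 : v + z = 0
  · right
    rwa [neg_eq_of_add_eq_zero_right hy0]
  · left
    have hy : StrictlyPositiveIn Ω ((v + z : Hs0 Ω s) : L2 N) := by
      refine strictlyPositiveIn_of_nonneg hp hL hu hN hs0 hs1 hΩo hΩb (lam := lam) (μ := μ) hy0 ?_ fun w => ?_
      · filter_upwards [hz, hadd] with x hx hx'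
        rw [Submodule.coe_add, hx', Pi.add_apply, hx]
        linarith [neg_abs_le ((v : L2 N) x)]
      · rw [map_add, LinearMap.add_apply, hv, hzeig, Submodule.coe_add, inner_add_left]
        ring
    have hvz : (v : L2 N) = z := by
      refine Lp.ext ?_
      filter_upwards [hz, hadd, hy.ae_pos hΩo, v.2.1, z.2.1] with x h1 h2 h3 h4 h5
      by_cases hx : x ∈ Ω
      · have h6 := h3 hx
        rw [Submodule.coe_add, h2, Pi.add_apply, h1] at h6
        rw [h1]
        refine (abs_of_nonneg ?_).symm
        by_contra! hneg
        rw [abs_of_neg hneg] at h6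
        linarith
      · rw [h4 hx, h5 hx]
    rwa [hvz]

lemma inner_pos_of_strictlyPositiveIn (hΩo : IsOpen Ω) {v w : L2 N} (hvH : v ∈ Hs0 Ω s)
    (hv0 : v ≠ 0) (hv : StrictlyPositiveIn Ω v) (hw : StrictlyPositiveIn Ω w) :
    0 < inner ℝ v w := by
  have hint : Integrable fun x => w x * v x := by
    simpa using L2.integrable_inner (𝕜 := ℝ) v w
  have heq : inner ℝ v w = ∫ x, w x * v x := by
    rw [L2.inner_def]
    simp
  have hnn : ∀ᵐ x, 0 ≤ w x * v x := by
    filter_upwards [hv.ae_pos hΩo, hw.ae_pos hΩo, hvH.1] with x h1 h2 h3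
    by_cases hx : x ∈ Ω
    · exact (mul_pos (h2 hx) (h1 hx)).le
    · rw [h3 hx, mul_zero]
  rw [heq]
  refine lt_of_le_of_ne (integral_nonneg_of_ae hnn) fun h0 => hv0 ?_
  have hzero := (integral_eq_zero_iff_of_nonneg_ae hnn hint).1 h0.symm
  refine (Lp.eq_zero_iff_ae_eq_zero).2 ?_
  filter_upwards [hv.ae_pos hΩo, hw.ae_pos hΩo, hvH.1, hzero] with x h1 h2 h3 h4
  by_cases hx : x ∈ Ω
  · exact absurd h4 (mul_pos (h2 hx) (h1 hx)).ne'
  · exact h3 hx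

/-- The lowest eigenvalue is simple. -/
lemma exists_smul_eq (hN : 0 < N) (hs0 : 0 < s) (hs1 : s < 1)
    (hΩo : IsOpen Ω) (hΩb : Bornology.IsBounded Ω) {μ : ℝ}
    (hmin : ∀ w : Hs0 Ω s, μ * ‖w‖ ^ 2 ≤ linearizedForm lam hp hL hu w w)
    {φ : Hs0 Ω s} (hφ0 : φ ≠ 0) (hφpos : StrictlyPositiveIn Ω (φ : L2 N))
    (hφ : ∀ w : Hs0 Ω s, linearizedForm lam hp hL hu φ w = μ * inner ℝ (φ : L2 N) (w : L2 N))
    (ψ : Hs0 Ω s)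
    (hψ : ∀ w : Hs0 Ω s, linearizedForm lam hp hL hu ψ w = μ * inner ℝ (ψ : L2 N) (w : L2 N)) :
    ∃ c : ℝ, ψ = c • φ := by
  have hφ0' : (φ : L2 N) ≠ 0 := fun h => hφ0 (Subtype.ext h)
  have hφn := inner_pos_of_strictlyPositiveIn hΩo φ.2 hφ0' hφpos hφpos
  set c := inner ℝ (φ : L2 N) (ψ : L2 N) / inner ℝ (φ : L2 N) (φ : L2 N) with hc
  refine ⟨c, sub_eq_zero.1 ?_⟩
  -- The remainder `ψ - c φ` would be an eigenfunction for `μ`, hence of strict sign, yet orthogonal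
  -- to the positive `φ`.
  by_contra hz0
  have hz : inner ℝ (φ : L2 N) ((ψ - c • φ : Hs0 Ω s) : L2 N) = 0 := by
    rw [Submodule.coe_sub, Submodule.coe_smul, inner_sub_right, inner_smul_right, hc,
      div_mul_cancel₀ _ hφn.ne', sub_self]
  rcases strictlyPositiveIn_or_neg hp hL hu hN hs0 hs1 hΩo hΩb hmin hz0 (fun w => by
    rw [map_sub, map_smul, LinearMap.sub_apply, LinearMap.smul_apply, hψ, hφ, Submodule.coe_sub,
      Submodule.coe_smul, inner_sub_left, real_inner_smul_left, smul_eq_mul]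
    ring) with h | h
  · exact (inner_pos_of_strictlyPositiveIn hΩo φ.2 hφ0' hφpos h).ne' hz
  · refine (inner_pos_of_strictlyPositiveIn hΩo φ.2 hφ0' hφpos h).ne' ?_
    rw [Submodule.coe_neg, inner_neg_right, hz, neg_zero]

/-- A cap supported in a smaller ball vanishes on an open part of `Ω`, where `φ > 0`, so it is not a
multiple of `φ`; its projection off `φ` is nonzero. This makes the minimization for the second
eigenvalue nonvacuous. -/
lemma exists_orthogonal_ne_zero (hN : 0 < N) (hs0 : 0 < s) (hs1 : s < 1)
    (hΩo : IsOpen Ω) (hne : Ω.Nonempty) {φ : Hs0 Ω s}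
    (hφpos : StrictlyPositiveIn Ω (φ : L2 N)) :
    ∃ v : Hs0 Ω s, v ≠ 0 ∧ inner ℝ (φ : L2 N) (v : L2 N) = 0 := by
  have : Nonempty (Fin N) := ⟨⟨0, hN⟩⟩
  have hopen : ∀ U : Set (Space N), IsOpen U → U.Nonempty → ¬ ∀ᵐ x, x ∉ U := fun U hU hUne h =>
    (hU.measure_pos volume hUne).ne' (measure_eq_zero_iff_ae_notMem.2 h)
  obtain ⟨x₀, hx₀⟩ := hne
  obtain ⟨r, hr, hball⟩ := Metric.isOpen_iff.1 hΩo x₀ hx₀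
  -- With `|y| = 3 r / 4`, the ball of radius `r / 8` about `x₀ + y` lies in the annulus between
  -- radii `r / 2` and `r`.
  obtain ⟨y, hy⟩ := exists_norm_eq (Space N) (by positivity : 0 ≤ 3 * r / 4)
  set η : Hs0 Ω s := ⟨(memLp_bump x₀ (r / 2)).toLp, bump_mem_Hs0 hN hs0 hs1 (half_pos hr)
    ((Metric.ball_subset_ball (by linarith)).trans hball)⟩ with hη
  have hηae : ∀ᵐ x, (η : L2 N) x = bump x₀ (r / 2) x := (memLp_bump x₀ (r / 2)).coeFn_toLp
  have hindep : ∀ c : ℝ, η ≠ c • φ := by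
    intro c heq
    have hcae : ∀ᵐ x, (η : L2 N) x = c * (φ : L2 N) x := by
      filter_upwards [Lp.coeFn_smul c (φ : L2 N)] with x hx
      rw [heq, Submodule.coe_smul, hx, Pi.smul_apply, smul_eq_mul]
    have hc0 : c ≠ 0 := by
      rintro rfl
      refine hopen (Metric.ball x₀ (r / 2)) Metric.isOpen_ball ⟨x₀, by simpa using hr⟩ ?_
      filter_upwards [hcae, hηae] with x h1 h2 hx
      rw [h2, zero_mul] at h1
      have h3 : (r / 2) ^ 2 - ‖x - x₀‖ ^ 2 ≤ 0 := max_eq_right_iff.1 h1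
      rw [Metric.mem_ball, dist_eq_norm] at hx
      nlinarith [norm_nonneg (x - x₀)]
    refine hopen (Metric.ball (x₀ + y) (r / 8)) Metric.isOpen_ball
      ⟨x₀ + y, by simpa using hr⟩ ?_
    filter_upwards [hcae, hηae, hφpos.ae_pos hΩo] with x h1 h2 h3 hx
    rw [Metric.mem_ball, dist_eq_norm] at hx
    have h4 : x - x₀ = (x - (x₀ + y)) + y := by abel
    have h5 : ‖x - x₀‖ < r := by
      rw [h4]
      exact (norm_add_le _ _).trans_lt (by linarith)
    have h6 : r / 2 ≤ ‖x - x₀‖ := by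
      have := norm_sub_le (x - x₀) (x - (x₀ + y))
      rw [show x - x₀ - (x - (x₀ + y)) = y by abel] at this
      linarith
    have h7 : bump x₀ (r / 2) x = 0 := bump_eq_zero (by positivity) (by
      rw [Metric.mem_ball, dist_eq_norm]; exact not_lt.2 h6)
    have h8 := h3 (hball (by rwa [Metric.mem_ball, dist_eq_norm]))
    rw [h2, h7] at h1
    exact (mul_ne_zero hc0 h8.ne') h1.symm
  by_cases hφn : inner ℝ (φ : L2 N) (φ : L2 N) = 0
  · have hφ0 : (φ : L2 N) = 0 := inner_self_eq_zero.1 hφn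
    exact ⟨η, fun h => hindep 0 (by rw [h, zero_smul]), by rw [hφ0, inner_zero_left]⟩
  · refine ⟨η - (inner ℝ (φ : L2 N) (η : L2 N) / inner ℝ (φ : L2 N) (φ : L2 N)) • φ,
      sub_ne_zero.2 (hindep _), ?_⟩
    rw [Submodule.coe_sub, Submodule.coe_smul, inner_sub_right, inner_smul_right,
      div_mul_cancel₀ _ hφn, sub_self]

/-- The quadratic form of the linearized problem attains its minimum on closed subspaces. -/
lemma exists_linearizedForm_minimizer (hs0 : 0 < s)
    (hΩb : Bornology.IsBounded Ω) {m : ℝ} (hm : 0 < m)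
    (h : ∀ v ∈ Hs0 Ω s, ∫ x in Ω, |v x| ^ (p + 1) ≠ 0 →
      m * (∫ x in Ω, |v x| ^ (p + 1)) ^ (2 / (p + 1)) ≤ energy Ω s lam v)
    {F : Submodule ℝ (L2 N)} (hF : IsClosed (F : Set (L2 N))) {v₀ : Hs0 Ω s} (hv₀ : v₀ ≠ 0)
    (hv₀F : (v₀ : L2 N) ∈ F) :
    ∃ v : Hs0 Ω s, (v : L2 N) ∈ F ∧ ‖v‖ = 1 ∧ ∀ w : Hs0 Ω s, (w : L2 N) ∈ F →
      linearizedForm lam hp hL hu v v * ‖w‖ ^ 2 ≤ linearizedForm lam hp hL hu w w := by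
  have hp0 : 0 < p := by linarith
  -- With `ε = 1 / (2 p)` the potential term `p ∫ |u|^(p-1) v²` absorbs half of the Gagliardo form,
  -- which gives the factor `2` in the lower comparison.
  obtain ⟨C, hC0, hC⟩ := exists_potential_le hp hm h hL hu
    (ε := 1 / (2 * p)) (by positivity)
  have hnorm : ∀ v : Hs0 Ω s, inner ℝ (v : L2 N) (v : L2 N) = ‖v‖ ^ 2 := fun v =>
    real_inner_self_eq_norm_sq _
  refine exists_rayleigh_minimizer (b := gagliardoForm Ω s) (C := 2 * (p * C + |lam|))
    (fun v => gagliardo_self_nonneg _ _) (fun v => ?_) (fun v => ?_) ?_ ?_ hF hv₀ hv₀F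
  · rw [linearizedForm_apply, gagliardoForm_apply, hnorm]
    have h1 := mul_le_mul_of_nonneg_left (hC v v.2) hp0.le
    have h2 : p * (1 / (2 * p) * gagliardo s (v : L2 N) (v : L2 N) + C * ‖(v : L2 N)‖ ^ 2) =
        gagliardo s (v : L2 N) (v : L2 N) / 2 + p * C * ‖v‖ ^ 2 := by
      rw [Submodule.coe_norm]
      field_simp
    rw [h2] at h1
    have h3 := mul_le_mul_of_nonneg_right (le_abs_self lam) (sq_nonneg ‖v‖)
    linarith
  · rw [linearizedForm_apply, gagliardoForm_apply, hnorm]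
    have h1 : 0 ≤ ∫ x in Ω, |u x| ^ (p - 1) * (v : L2 N) x * (v : L2 N) x :=
      integral_nonneg fun x => by
        rw [mul_assoc]
        exact mul_nonneg (Real.rpow_nonneg (abs_nonneg _) _) (mul_self_nonneg _)
    have h2 := mul_nonneg hp0.le h1
    have h3 := mul_le_mul_of_nonneg_right (neg_abs_le lam) (sq_nonneg ‖v‖)
    have h4 : 0 ≤ p * C * ‖v‖ ^ 2 := by positivity
    have h5 : 0 ≤ |lam| * ‖v‖ ^ 2 := by positivity
    linarith
  · intro v x M hv hx
    have := Hs0.of_tendsto (fun n => (v n).2) hx hv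
    exact ⟨this.1, this.2⟩
  · intro v M hv hv1
    exact Hs0.exists_tendsto_subseq hs0 hΩb (fun n => (v n).2) hv hv1

end Linearized

/-! ### Counting eigenvalues with multiplicity. -/

lemma IsKthEigenvalue.one {N : ℕ} {Ω : Set (Space N)} {s p lam μ : ℝ} {u φ : L2 N}
    (hφ : IsEigenfunction Ω s p lam u μ φ)
    (hmin : ∀ (ν : ℝ) (v : L2 N), IsEigenfunction Ω s p lam u ν v → μ ≤ ν) :
    IsKthEigenvalue Ω s p lam u 1 μ := by
  refine ⟨⟨fun _ => φ, LinearIndependent.of_subsingleton 0 hφ.2.1, fun _ => ⟨μ, le_rfl, hφ⟩⟩, ?_⟩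
  rintro m ⟨v, -, hv⟩
  obtain ⟨ν, hνm, hν⟩ := hv 0
  exact (hmin ν _ hν).trans hνm

lemma IsKthEigenvalue.two {N : ℕ} {Ω : Set (Space N)} {s p lam μ₁ μ₂ : ℝ} {u φ v₂ : L2 N}
    (hμ : μ₁ ≤ μ₂) (hφ : IsEigenfunction Ω s p lam u μ₁ φ)
    (hv₂ : IsEigenfunction Ω s p lam u μ₂ v₂) (hind : ∀ c : ℝ, v₂ ≠ c • φ)
    (hmin : ∀ (ν : ℝ) (v : L2 N), IsEigenfunction Ω s p lam u ν v → ν < μ₂ →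
      ∃ c : ℝ, v = c • φ) :
    IsKthEigenvalue Ω s p lam u 2 μ₂ := by
  refine ⟨⟨![v₂, φ], ?_, ?_⟩, ?_⟩
  · rw [linearIndependent_fin2]
    exact ⟨hφ.2.1, fun c h => hind c h.symm⟩
  · intro i
    fin_cases i
    · exact ⟨μ₂, le_rfl, hv₂⟩
    · exact ⟨μ₁, hμ, hφ⟩
  · rintro m ⟨v, hli, hv⟩
    by_contra! hm
    obtain ⟨ν, hνm, hν⟩ := hv 0
    obtain ⟨ν', hνm', hν'⟩ := hv 1
    obtain ⟨c, hc⟩ := hmin ν _ hν (hνm.trans_lt hm)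
    obtain ⟨c', hc'⟩ := hmin ν' _ hν' (hνm'.trans_lt hm)
    -- Both eigenfunctions are multiples `c φ` and `c' φ`, so the coefficients `c'` and `-c` give a
    -- linear relation; independence forces `c' = 0`.
    have h0 := Fintype.linearIndependent_iff.1 hli ![c', -c] (by
      simp [Fin.sum_univ_two, hc, hc', smul_smul, mul_comm])
    have h1 : c' = 0 := h0 0
    exact hν'.2.1 (by rw [hc', h1, zero_smul])

end FracLinearized

/-! ### The main theorem. -/

open FracLinearized

theorem proposition3p1 (N : ℕ) (s p lam : ℝ) (hs0 : 0 < s) (hs1 : s < 1)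
    (hsN : 2 * s < N) (hp1 : 1 < p) (hp2 : p < ((N : ℝ) + 2 * s) / ((N : ℝ) - 2 * s))
    (Ω : Set (FracLinearized.Space N)) (hΩo : IsOpen Ω) (hΩb : Bornology.IsBounded Ω)
    (hlam : lam < FracLinearized.firstDirichletEigenvalue Ω s)
    (u : FracLinearized.L2 N) (hu : FracLinearized.IsLeastEnergySolution Ω s p lam u) :
    ∃ μ₁ μ₂ : ℝ,
      FracLinearized.IsKthEigenvalue Ω s p lam u 1 μ₁ ∧
      FracLinearized.IsKthEigenvalue Ω s p lam u 2 μ₂ ∧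
      μ₁ < 0 ∧
      (∃ φ : FracLinearized.L2 N,
        FracLinearized.IsEigenfunction Ω s p lam u μ₁ φ ∧
        FracLinearized.StrictlyPositiveIn Ω φ ∧
        ∀ ψ : FracLinearized.L2 N,
          FracLinearized.IsEigenfunction Ω s p lam u μ₁ ψ ↔ ∃ c : ℝ, c ≠ 0 ∧ ψ = c • φ) ∧
      μ₁ < μ₂ := by

  have hN : 0 < N := by
    have : (0 : ℝ) < N := by linarith
    exact_mod_cast this
  have hΩm : MeasurableSet Ω := hΩo.measurableSet
  obtain ⟨hpos, m, hm, hsob⟩ := hu.sobolev hp1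
  have huH : u ∈ Hs0 Ω s := hu.1.1
  have hL : ∀ v ∈ Hs0 Ω s, IntegrableOn (fun x => |v x| ^ (p + 1)) Ω := fun v hv =>
    integrableOn_abs_rpow hΩb.measure_lt_top.ne hp1 hm hsob hv
  have hu0 : u ≠ 0 := by
    rintro rfl
    have := energy_smul Ω s lam 0 (0 : L2 N)
    rw [zero_smul] at this
    linarith
  have hΩne : Ω.Nonempty := by
    by_contra hemp
    rw [Set.not_nonempty_iff_eq_empty] at hemp
    refine hu0 ((Lp.eq_zero_iff_ae_eq_zero).2 ?_)
    filter_upwards [huH.1] with x hx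
    exact hx (by simp [hemp])
  set a := linearizedForm lam hp1 hL huH with ha
  have hsymm : ∀ v w, a v w = a w v := linearizedForm_comm hp1 hL huH
  have hiff : ∀ (μ : ℝ) (v : Hs0 Ω s), IsEigenfunction Ω s p lam u μ v ↔
      v ≠ 0 ∧ ∀ w : Hs0 Ω s, a v w = μ * inner ℝ (v : L2 N) (w : L2 N) := fun μ v =>
    isEigenfunction_iff hp1 hL huH hΩm v
  set U : Hs0 Ω s := ⟨u, huH⟩ with hU
  have hU0 : U ≠ 0 := fun h => hu0 (congrArg Subtype.val h)
  obtain ⟨v₁, -, hv₁n, hmin'⟩ := exists_linearizedForm_minimizer (lam := lam) hp1 hL huH hs0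
    hΩb hm hsob (F := ⊤) isClosed_univ hU0 trivial
  set μ₁ := a v₁ v₁ with hμ₁
  have hmin : ∀ w : Hs0 Ω s, μ₁ * ‖w‖ ^ 2 ≤ a w w := fun w => hmin' w trivial
  have hv₁0 : v₁ ≠ 0 := by
    rintro rfl
    simp at hv₁n
  have hv₁ : ∀ w : Hs0 Ω s, a v₁ w = μ₁ * inner ℝ (v₁ : L2 N) (w : L2 N) := fun w =>
    euler_lagrange hsymm (F := ⊤) (fun w _ => hmin w) trivial (by rw [hv₁n]; simp [hμ₁]) trivial
  obtain ⟨φ, hφ0, hφpos, hφ⟩ : ∃ φ : Hs0 Ω s, φ ≠ 0 ∧ StrictlyPositiveIn Ω (φ : L2 N) ∧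
      ∀ w : Hs0 Ω s, a φ w = μ₁ * inner ℝ (φ : L2 N) (w : L2 N) := by
    rcases strictlyPositiveIn_or_neg hp1 hL huH hN hs0 hs1 hΩo hΩb hmin hv₁0 hv₁ with h | h
    · exact ⟨v₁, hv₁0, h, hv₁⟩
    · refine ⟨-v₁, neg_ne_zero.2 hv₁0, h, fun w => ?_⟩
      rw [map_neg, LinearMap.neg_apply, hv₁, Submodule.coe_neg, inner_neg_left, mul_neg]
  have hsimple := exists_smul_eq hp1 hL huH hN hs0 hs1 hΩo hΩb hmin hφ0 hφpos hφ
  obtain ⟨v₀, hv₀0, hv₀φ⟩ := exists_orthogonal_ne_zero hN hs0 hs1 hΩo hΩne hφpos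
  have hF : ∀ w : Hs0 Ω s, (w : L2 N) ∈ (ℝ ∙ (φ : L2 N))ᗮ ↔
      inner ℝ (φ : L2 N) (w : L2 N) = 0 := fun w =>
    Submodule.mem_orthogonal_singleton_iff_inner_right
  -- The second eigenvalue is the minimum of the Rayleigh quotient on the orthogonal complement of
  -- `φ`.
  obtain ⟨v₂, hv₂F, hv₂n, hmin₂⟩ := exists_linearizedForm_minimizer (lam := lam) hp1 hL huH hs0
    hΩb hm hsob (F := (ℝ ∙ (φ : L2 N))ᗮ) (Submodule.isClosed_orthogonal _) hv₀0
    ((hF v₀).2 hv₀φ)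
  set μ₂ := a v₂ v₂ with hμ₂
  have hv₂0 : v₂ ≠ 0 := by
    rintro rfl
    simp at hv₂n
  obtain ⟨hv₂, hlt, hbelow⟩ := second_eigenvalue hsymm hmin hφ0 hφ hsimple ((hF v₂).1 hv₂F) hv₂0
    (μ₂ := μ₂) (by rw [hv₂n]; simp [hμ₂]) fun w hw => hmin₂ w ((hF w).2 hw)
  have hφeig : IsEigenfunction Ω s p lam u μ₁ φ := (hiff μ₁ φ).2 ⟨hφ0, hφ⟩
  have hv₂eig : IsEigenfunction Ω s p lam u μ₂ v₂ := (hiff μ₂ v₂).2 ⟨hv₂0, hv₂⟩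
  refine ⟨μ₁, μ₂, IsKthEigenvalue.one hφeig fun ν v hv => ?_,
    IsKthEigenvalue.two hlt.le hφeig hv₂eig (fun c hc => ?_) fun ν v hv hν => ?_, ?_,
    ⟨φ, hφeig, hφpos, fun ψ => ⟨fun hψ => ?_, ?_⟩⟩, hlt⟩
  · obtain ⟨hv0, hv'⟩ := (hiff ν ⟨v, hv.1⟩).1 hv
    have h1 := hmin ⟨v, hv.1⟩
    rw [hv', ← Submodule.coe_inner, real_inner_self_eq_norm_sq] at h1
    exact le_of_mul_le_mul_right h1 (pow_pos (norm_pos_iff.2 hv0) 2)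
  · have h1 := (hF v₂).1 hv₂F
    rw [hc, inner_smul_right, real_inner_self_eq_norm_sq] at h1
    rcases mul_eq_zero.1 h1 with h | h
    · exact hv₂eig.2.1 (by rw [hc, h, zero_smul])
    · exact hφeig.2.1 (norm_eq_zero.1 (pow_eq_zero_iff two_ne_zero |>.1 h))
  · obtain ⟨hv0, hv'⟩ := (hiff ν ⟨v, hv.1⟩).1 hv
    obtain ⟨c, hc⟩ := hbelow ν ⟨v, hv.1⟩ hv0 hv' hν
    exact ⟨c, congrArg Subtype.val hc⟩
  · have h1 := hmin U
    -- The equation tested with `u` identifies `∫ |u|^(p+1)` with the energy, which is positive;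
    -- since `p > 1`, the form is negative at `u` and so is its minimum.
    have h2 : a U U = (1 - p) * energy Ω s lam u := by
      have h3 : ∀ x, |u x| ^ (p - 1) * u x * u x = |u x| ^ (p + 1) := abs_rpow_mul_self hp1 u
      have h4 := hu.1.energy_eq hp1
      have h5 : gagliardo s u u - lam * inner ℝ u u = energy Ω s lam u := by
        rw [← Hs0.setIntegral_eq huH hΩm]
        simp only [energy, sq]
      rw [ha, linearizedForm_apply]
      simp only [hU, h3]
      rw [← h4]
      linarith
    have h3 : 0 < ‖U‖ ^ 2 := pow_pos (norm_pos_iff.2 hU0) 2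
    by_contra! h4
    have h5 := mul_nonneg h4 h3.le
    nlinarith
  · obtain ⟨hψ0, hψ'⟩ := (hiff μ₁ ⟨ψ, hψ.1⟩).1 hψ
    obtain ⟨c, hc⟩ := hsimple ⟨ψ, hψ.1⟩ hψ'
    refine ⟨c, ?_, congrArg Subtype.val hc⟩
    rintro rfl
    exact hψ0 (by rw [hc, zero_smul])
  · rintro ⟨c, hc, rfl⟩
    refine (hiff μ₁ (c • φ)).2 ⟨smul_ne_zero hc hφ0, fun w => ?_⟩
    rw [map_smul, LinearMap.smul_apply, hφ, Submodule.coe_smul, real_inner_smul_left, smul_eq_mul]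
    ring
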